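/- Let $d\ge 2$, let $\mathbb T^d=\mathbb R^d/\mathbb Z^d$, $\mathbb Z^d_0=\mathbb Z^d\setminus\{0\}$, $e_k(x)=e^{2\pi i k\cdot x}$, and let $\kappa,\nu,\delta>0$. Let $\theta=(\theta_k)_{k\in\mathbb Z^d_0}$ be real with $\theta_k=\theta_l$ whenever $|k|=|l|$ and $\sum_k\theta_k^2=1$; write $\|\theta\|_{\ell^\infty}=\sup_k|\theta_k|$. For $k\in\mathbb Z^d_0$ let $\{a_{k,i}\}_{i=1}^{d-1}$ be an orthonormal basis of $k^\perp\subset\mathbb R^d$ with $a_{-k,i}=a_{k,i}$, and put $\sigma_{k,i}=a_{k,i}e_k$. On a filtered probability space $(\Omega,\mathcal F,(\mathcal F_t)_{t\ge0},\mathbb P)$ let $W^{k,i}$ ($k\in\mathbb Z^d_0$, $1\le i\le d-1$) be standard complex $(\mathcal F_t)$-Brownian motions that are independent up to the constraint $\overline{W^{k,i}}=W^{-k,i}$, so that $[W^{k,i},W^{l,j}]_t=2t\,\delta_{k,-l}\delta_{i,j}$. Let $\Pi$ be the Helmholtz projection, $\Pi X=\sum_{l\in\mathbb Z_0^d}\big(I_d-\frac{l\otimes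 l}{|l|^2}\big)X_l e_l$ for $X=\sum_l X_l e_l$. Let $(f_t)_{t\ge0}$ be a progressively measurable process with values in the mean-zero vector fields of $L^2(\mathbb T^d,\mathbb R^d)$ such that, almost surely, $$\|f_t\|_{L^2}^2+\nu\int_s^t\|\nabla f_r\|_{L^2}^2\,dr\le\|f_s\|_{L^2}^2\qquad\text{for all } t>s\ge0,$$ where $\|\nabla u\|_{L^2}=\infty$ if $u\notin H^1$. For $0\le s\le t$ let $$Z_{s,t}=\sqrt{\tfrac{d}{d-1}\,\kappa}\;\sum_{k\in\mathbb Z^d_0}\sum_{i=1}^{d-1}\theta_k\int_s^t e^{\delta(t-r)\Delta}\,\Pi(\sigma_{k,i}\cdot\nabla f_r)\,dW^{k,i}_r$$ (Itô integrals of $L^2$-valued processes, the series converging in $L^2(\Omega;L^2)$). Then for all $\alpha,\beta$ with $0<\alpha<1\le\frac d2<\beta$ there is a constant $C>0$ depending only on $\alpha$ and $\beta$ such that, for every $n\ge0$, $$\int_n^{n+1}\mathbb E\|Z_{n,t}\|_{L^2}^2\,dt\le C\,\kappa\,\nu^{-\frac{\beta}{\alpha+\beta}}\,\delta^{-\frac{\alpha(2\beta+d+4)}{4(\alpha+\beta)}}\,\|\theta\|_{\ell^\infty}^{\frac{2\alpha}{\alpha+\beta}}\,\mathbb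 E\|f_n\|_{L^2}^2 .$$ -/

import Mathlib

open MeasureTheory ProbabilityTheory Filter Topology
open scoped NNReal ENNReal ComplexConjugate

noncomputable section

namespace TransportNoise

/-! ### Vector fields on the torus and Fourier analysis -/

/-- The normalised Haar measure (total mass one) on the torus `𝕋ᵈ = ℝᵈ / ℤᵈ`. -/
abbrev torusMeasure (d : ℕ) : Measure (UnitAddTorus (Fin d)) :=
  Measure.pi fun _ => AddCircle.haarAddCircle

/-- The Hilbert space `L²(𝕋ᵈ, ℂ)`. -/
abbrev ScalarField (d : ℕ) : Type := Lp ℂ 2 (torusMeasure d)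

/-- The Hilbert space `L²(𝕋ᵈ, ℂᵈ)` of square integrable vector fields, as `d`-tuples of scalar
fields with `‖u‖² = ∑ⱼ ‖uⱼ‖²`. -/
abbrev VectorField (d : ℕ) : Type := PiLp 2 fun _ : Fin d => ScalarField d

/-- The nonzero frequencies `ℤᵈ \ {0}`. -/
abbrev NonzeroFreq (d : ℕ) : Type := {k : Fin d → ℤ // k ≠ 0}

/-- The frequency `-k`. -/
def negFreq {d : ℕ} (k : NonzeroFreq d) : NonzeroFreq d := ⟨-k.1, neg_ne_zero.2 k.2⟩

/-- The squared Euclidean length `|k|²` of a frequency. -/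
def freqSq {d : ℕ} (k : Fin d → ℤ) : ℝ := ∑ j, (k j : ℝ) ^ 2

/-- The basis element `e_k(x) = exp (2πi k·x)` of `L²(𝕋ᵈ, ℂ)`. -/
def basisFun {d : ℕ} (k : Fin d → ℤ) : ScalarField d :=
  ContinuousMap.toLp (E := ℂ) 2 (torusMeasure d) ℂ (UnitAddTorus.mFourier k)

/-- The `k`-th Fourier coefficient `⟨u, e_k⟩ = ∫ u(x) exp (-2πi k·x) dx`. -/
def fourierCoef {d : ℕ} (u : ScalarField d) (k : Fin d → ℤ) : ℂ :=
  ∫ x, UnitAddTorus.mFourier (-k) x * u x ∂(torusMeasure d)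

/-- The vector field is `ℝᵈ`-valued. -/
def IsRealField {d : ℕ} (u : VectorField d) : Prop :=
  ∀ j, ∀ᵐ x ∂(torusMeasure d), (u j x).im = 0

/-- The vector field has zero average. -/
def HasZeroMean {d : ℕ} (u : VectorField d) : Prop :=
  ∀ j, ∫ x, u j x ∂(torusMeasure d) = 0

/-- `‖∇u‖²_{L²} = ∑ⱼ ∑ₗ 4π²|l|² |⟨uⱼ, e_l⟩|²`, which is `∞` when `u` is not in `H¹`. -/
def gradNormSq {d : ℕ} (u : VectorField d) : ℝ≥0∞ :=
  ∑ j, ∑' l : Fin d → ℤ,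
    ENNReal.ofReal (4 * Real.pi ^ 2 * freqSq l) * ‖fourierCoef (u j) l‖ₑ ^ 2

/-- The weak partial derivative `∂ⱼ u = ∑ₗ 2πi lⱼ ⟨u, e_l⟩ e_l`. For `u ∈ H¹` the series converges
in `L²`; it is only evaluated meaningfully there. -/
def partialDeriv {d : ℕ} (j : Fin d) (u : ScalarField d) : ScalarField d :=
  ∑' l : Fin d → ℤ, (2 * Real.pi * Complex.I * (l j : ℂ) * fourierCoef u l) • basisFun l

/-- Pointwise multiplication of `u ∈ L²` by the bounded function `e_k`. -/
def mulBasis {d : ℕ} (k : Fin d → ℤ) (u : ScalarField d) : ScalarField d :=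
  (ContinuousMap.toLp (E := ℂ) ∞ (torusMeasure d) ℂ (UnitAddTorus.mFourier k) :
    Lp ℂ ∞ (torusMeasure d)) • u

/-- The transport term `σ·∇u`, with components `∑ⱼ aⱼ e_k ∂ⱼuₘ`, for the field `σ = a e_k`. -/
def transport {d : ℕ} (k : Fin d → ℤ) (a : EuclideanSpace ℝ (Fin d)) (u : VectorField d) :
    VectorField d :=
  WithLp.toLp 2 fun m => ∑ j, (a j : ℂ) • mulBasis k (partialDeriv j (u m))

/-- The Helmholtz projection `Π X = ∑_{l ≠ 0} (I - l ⊗ l / |l|²) X_l e_l`. -/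
def helmholtz {d : ℕ} (X : VectorField d) : VectorField d :=
  WithLp.toLp 2 fun m => ∑' l : NonzeroFreq d,
    (fourierCoef (X m) l.1 -
      (l.1 m : ℂ) * (∑ j, (l.1 j : ℂ) * fourierCoef (X j) l.1) / (freqSq l.1 : ℂ)) • basisFun l.1

/-- The heat semigroup `e^{τΔ} X = ∑ₗ exp (-4π²|l|²τ) X_l e_l`. -/
def heat {d : ℕ} (τ : ℝ) (X : VectorField d) : VectorField d :=
  WithLp.toLp 2 fun m => ∑' l : Fin d → ℤ,
    ((Real.exp (-(4 * Real.pi ^ 2 * freqSq l * τ)) : ℂ) * fourierCoef (X m) l) • basisFun l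

/-! ### The noise -/

/-- The noise coefficients: `θ` is radially symmetric and `‖θ‖_{ℓ²} = 1`. -/
structure IsNoiseCoeff {d : ℕ} (θ : NonzeroFreq d → ℝ) : Prop where
  symm : ∀ k l : NonzeroFreq d, freqSq k.1 = freqSq l.1 → θ k = θ l
  norm_one : HasSum (fun k => θ k ^ 2) 1

/-- The directions `a_{k,i}`: for each `k`, an orthonormal family of `d - 1` vectors of the
`(d-1)`-dimensional space `k^⊥` (hence an orthonormal basis of it), with `a_{-k,i} = a_{k,i}`. -/
structure IsNoiseFrame {d : ℕ} (a : NonzeroFreq d → Fin (d - 1) → EuclideanSpace ℝ (Fin d)) :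
    Prop where
  symm : ∀ k i, a (negFreq k) i = a k i
  orthonormal : ∀ k, Orthonormal ℝ (a k)
  perp : ∀ k i, ∑ j, a k i j * (k.1 j : ℝ) = 0

variable {Ω : Type*} [mΩ : MeasurableSpace Ω]

/-- The real and imaginary parts of a complex process. -/
def reIm (w : ℝ≥0 → Ω → ℂ) (b : Bool) (t : ℝ≥0) (ω : Ω) : ℝ :=
  if b then (w t ω).re else (w t ω).im

/-- `W^{k,i}` are standard complex Brownian motions for the filtration `𝓕`, independent up to the
constraint `W^{-k,i} = conj W^{k,i}`: for a half `S` of the nonzero frequencies, the real and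
imaginary parts of `W^{k,i}`, `k ∈ S`, are independent standard real Brownian motions. In terms of
brackets, `[W^{k,i}, W^{l,j}]_t = 2 t δ_{k,-l} δ_{i,j}`. -/
structure IsNoise {d : ℕ} (𝓕 : Filtration ℝ≥0 mΩ) (P : Measure Ω)
    (W : NonzeroFreq d → Fin (d - 1) → ℝ≥0 → Ω → ℂ) : Prop where
  adapted : ∀ k i, StronglyAdapted 𝓕 (W k i)
  conj_symm : ∀ k i, ∀ᵐ ω ∂P, ∀ t, W (negFreq k) i t ω = conj (W k i t ω)
  brownian : ∀ k i b, IsBrownianReal (reIm (W k i) b) P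
  indep_modes : ∃ S : Set (NonzeroFreq d), (∀ k, k ∈ S ↔ negFreq k ∉ S) ∧
    iIndepFun (fun (p : S × Fin (d - 1) × Bool) (ω : Ω) (t : ℝ≥0) =>
      reIm (W p.1.1 p.2.1) p.2.2 t ω) P
  indep_past : ∀ s t, s ≤ t →
    Indep (MeasurableSpace.comap
      (fun ω (p : NonzeroFreq d × Fin (d - 1)) => W p.1 p.2 t ω - W p.1 p.2 s ω)
      MeasurableSpace.pi) (𝓕 s) P

/-! ### The Itô integral -/

/-- A simple adapted process `∑_{i < N} ξᵢ 1_{(τᵢ, τᵢ₊₁]}`, with `ξᵢ` bounded and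
`𝓕_{τᵢ}`-measurable. -/
structure SimpleProcess (𝓕 : Filtration ℝ≥0 mΩ) (E : Type*) [NormedAddCommGroup E] where
  N : ℕ
  τ : ℕ → ℝ≥0
  τ_mono : Monotone τ
  ξ : ℕ → Ω → E
  ξ_meas : ∀ i, StronglyMeasurable[𝓕 (τ i)] (ξ i)
  ξ_bdd : ∀ i, ∃ M : ℝ, ∀ ω, ‖ξ i ω‖ ≤ M

/-- The value of a simple process at time `r`. -/
def SimpleProcess.val {𝓕 : Filtration ℝ≥0 mΩ} {E : Type*} [NormedAddCommGroup E]
    (X : SimpleProcess 𝓕 E) (r : ℝ≥0) (ω : Ω) : E :=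
  ∑ i ∈ Finset.range X.N, (Set.Ioc (X.τ i) (X.τ (i + 1))).indicator (fun _ => X.ξ i ω) r

/-- The integral `∑_{i < N} (w_{τᵢ₊₁} - w_{τᵢ}) ξᵢ` of a simple process. -/
def SimpleProcess.integral {𝓕 : Filtration ℝ≥0 mΩ} {E : Type*} [NormedAddCommGroup E]
    [NormedSpace ℂ E] (X : SimpleProcess 𝓕 E) (w : ℝ≥0 → Ω → ℂ) (ω : Ω) : E :=
  ∑ i ∈ Finset.range X.N, (w (X.τ (i + 1)) ω - w (X.τ i) ω) • X.ξ i ω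

/-- `Y = ∫_s^t Φ_r dw_r` in the sense of Itô: `Φ` is the limit in `L²((s,t] × Ω; E)` of simple
adapted processes supported in `(s,t]` whose integrals converge to `Y` in `L²(Ω; E)`. -/
def IsItoIntegral (𝓕 : Filtration ℝ≥0 mΩ) (P : Measure Ω) {E : Type*} [NormedAddCommGroup E]
    [NormedSpace ℂ E] (w : ℝ≥0 → Ω → ℂ) (s t : ℝ≥0) (Φ : ℝ≥0 → Ω → E) (Y : Ω → E) : Prop :=
  AEStronglyMeasurable Y P ∧
  ∃ X : ℕ → SimpleProcess 𝓕 E,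
    (∀ m i, (X m).τ i ∈ Set.Icc s t) ∧
    Tendsto (fun m => ∫⁻ r in Set.Ioc (s : ℝ) t,
      ∫⁻ ω, ‖(X m).val r.toNNReal ω - Φ r.toNNReal ω‖ₑ ^ 2 ∂P) atTop (𝓝 0) ∧
    Tendsto (fun m => ∫⁻ ω, ‖(X m).integral w ω - Y ω‖ₑ ^ 2 ∂P) atTop (𝓝 0)

/-! ### The energy inequality and the stochastic convolution -/

/-- Almost surely, `‖f_t‖² + ν ∫_s^t ‖∇f_r‖² dr ≤ ‖f_s‖²` for all `t > s ≥ 0`. -/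
def EnergyInequality {d : ℕ} (P : Measure Ω) (ν : ℝ) (f : ℝ≥0 → Ω → VectorField d) : Prop :=
  ∀ᵐ ω ∂P, ∀ s t : ℝ≥0, s < t →
    ‖f t ω‖ₑ ^ 2 + ENNReal.ofReal ν * ∫⁻ r in Set.Ioc (s : ℝ) t, gradNormSq (f r.toNNReal ω)
      ≤ ‖f s ω‖ₑ ^ 2

/-- `Z` is (a version of) the stochastic convolution
`Z_{s,t} = √(C_d κ) ∑_{k,i} θ_k ∫_s^t e^{δ(t-r)Δ} Π(σ_{k,i}·∇f_r) dW^{k,i}_r`, where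
`C_d = d/(d-1)`, `σ_{k,i} = a_{k,i} e_k`, and the series converges in `L²(Ω; L²(𝕋ᵈ))`. -/
def IsStochConvolution {d : ℕ} (𝓕 : Filtration ℝ≥0 mΩ) (P : Measure Ω) (κ δ : ℝ)
    (θ : NonzeroFreq d → ℝ) (a : NonzeroFreq d → Fin (d - 1) → EuclideanSpace ℝ (Fin d))
    (W : NonzeroFreq d → Fin (d - 1) → ℝ≥0 → Ω → ℂ) (f : ℝ≥0 → Ω → VectorField d)
    (s t : ℝ≥0) (Z : Ω → VectorField d) : Prop :=
  AEStronglyMeasurable Z P ∧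
  ∃ Y : NonzeroFreq d × Fin (d - 1) → Ω → VectorField d,
    (∀ p, IsItoIntegral 𝓕 P (W p.1 p.2) s t
      (fun r ω => heat (δ * ((t : ℝ) - r)) (helmholtz (transport p.1.1 (a p.1 p.2) (f r ω))))
      (Y p)) ∧
    Tendsto (fun S : Finset (NonzeroFreq d × Fin (d - 1)) =>
      ∫⁻ ω, ‖(∑ p ∈ S, ((√((d : ℝ) / ((d : ℝ) - 1) * κ) * θ p.1 : ℝ) : ℂ) • Y p ω) - Z ω‖ₑ ^ 2 ∂P)
      atTop (𝓝 0)

end TransportNoise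

end

namespace TransportNoise

/-! ### Fourier series in `L²(𝕋ᵈ)` -/

/-! Since distinct noise modes have orthogonal increments, the second moment of the stochastic
convolution is at most an absolute constant times κ ∫ ∑ₗ exp(-2xδ(t-r)) E mₗ(f_r) dr, where x =
4π²|l|² and mₗ(u) = `modeEnergy θ a u l` is the energy that the transport noise sends into frequency
l. The heat semigroup acts diagonally and the Helmholtz projection does not increase the size of any
Fourier coefficient, so neither spoils this bound.

The theorem is an interpolation between two bounds on mₗ. Because a_{k,i} ⊥ k, the symbol of the
transport term may be read as a·l or as a·(l-k). Reading it at l gives mₗ ≤ ‖θ‖∞² x ‖u‖²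
(`modeEnergy_le`), small in θ but growing in l. Reading it at l-k and using ∑ θ_k² = 1 gives ∑ₗ mₗ ≤
‖∇u‖² (`tsum_modeEnergy_le`), summable but not small. Integrating the exponential over a unit time
interval gains (xδ)^(-η) for any η in [0,1] (`lintegral_exp_neg_le`).

Put μ = α/(α+β), λ = β/(α+β), b = (2β+d)/4 and η = μ(b+1). Write mₗ = mₗ^λ mₗ^μ and use the first
bound on the second factor: the weight left over is x^(-μb). Hölder in l leaves (∑ mₗ)^λ (∑
x^(-b))^μ, and the lattice sum converges as b > d/2 (`tsum_modeEnergy_mul_le`, `latticeSum_ne_top`).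
Hölder in time and the energy inequality then bound the integral of ‖∇f‖^(2λ) ‖f‖^(2μ) by ν^(-λ)
‖f_n‖² (`lintegral_interpolation_le`).

On the probabilistic side, `lintegral_enorm_sq_sum_integral_le` is the Itô isometry for simple
integrands on a common grid, and `lintegral_enorm_sq_sum_ito_le` passes to the limit. Constants are
not optimised there, which permits the crude inequality ‖x+y‖² ≤ 2‖x‖² + 2‖y‖². -/

/-- The Fourier basis of `L²(𝕋ᵈ, ℂ)`. -/
noncomputable def torusFourierBasis (d : ℕ) : HilbertBasis (Fin d → ℤ) ℂ (ScalarField d) :=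
  UnitAddTorus.mFourierBasis

variable {d : ℕ}

theorem torusFourierBasis_apply (k : Fin d → ℤ) : torusFourierBasis d k = basisFun k :=
  congrFun UnitAddTorus.coe_mFourierBasis k

theorem torusFourierBasis_repr (u : ScalarField d) (k : Fin d → ℤ) :
    (torusFourierBasis d).repr u k = fourierCoef u k :=
  UnitAddTorus.mFourierBasis_repr u k

theorem fourierCoef_eq_inner (u : ScalarField d) (k : Fin d → ℤ) :
    fourierCoef u k = inner ℂ (basisFun k) u := by
  rw [← torusFourierBasis_repr, HilbertBasis.repr_apply_apply, torusFourierBasis_apply]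

theorem continuous_fourierCoef (k : Fin d → ℤ) :
    Continuous fun u : ScalarField d => fourierCoef u k := by
  simp only [fourierCoef_eq_inner]
  fun_prop

theorem fourierCoef_sum_smul {ι : Type*} (s : Finset ι) (c : ι → ℂ) (u : ι → ScalarField d)
    (k : Fin d → ℤ) :
    fourierCoef (∑ j ∈ s, c j • u j) k = ∑ j ∈ s, c j * fourierCoef (u j) k := by
  simp only [fourierCoef_eq_inner, inner_sum, inner_smul_right]

theorem orthonormal_basisFun : Orthonormal ℂ (basisFun (d := d)) := by
  have h := (torusFourierBasis d).orthonormal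
  rwa [show ⇑(torusFourierBasis d) = basisFun from funext torusFourierBasis_apply] at h

/-- Parseval's identity. -/
theorem enorm_sq_eq_tsum_fourierCoef (u : ScalarField d) :
    ‖u‖ₑ ^ 2 = ∑' l, ‖fourierCoef u l‖ₑ ^ 2 := by
  have h : HasSum (fun l => ‖fourierCoef u l‖ ^ 2) (‖u‖ ^ 2) := by
    have := lp.hasSum_norm (p := 2) (by norm_num) ((torusFourierBasis d).repr u)
    simpa [torusFourierBasis_repr] using this
  have h2 := ENNReal.ofReal_tsum_of_nonneg (fun l => by positivity) h.summable
  rw [h.tsum_eq] at h2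
  simpa [ENNReal.ofReal_pow, ofReal_norm] using h2

theorem fourierCoef_tsum_eq_of_summable {ι : Type*} {g : ι → Fin d → ℤ} (hg : Function.Injective g)
    {c : ι → ℂ} (hc : Summable fun l => c l • basisFun (g l)) (l : ι) :
    fourierCoef (∑' l, c l • basisFun (g l)) (g l) = c l := by
  classical
  rw [fourierCoef_eq_inner, ← innerSL_apply_apply ℂ, ContinuousLinearMap.map_tsum _ hc,
    tsum_eq_single l]
  · simp [orthonormal_basisFun.1]
  · intro l' h
    simp [orthonormal_iff_ite.1 (orthonormal_basisFun (d := d)), hg.ne h.symm]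

theorem fourierCoef_tsum_eq_zero {ι : Type*} {g : ι → Fin d → ℤ}
    (c : ι → ℂ) {k : Fin d → ℤ} (hk : ∀ l, g l ≠ k) :
    fourierCoef (∑' l, c l • basisFun (g l)) k = 0 := by
  classical
  by_cases hc : Summable fun l => c l • basisFun (g l)
  · rw [fourierCoef_eq_inner, ← innerSL_apply_apply ℂ, ContinuousLinearMap.map_tsum _ hc]
    simp [orthonormal_iff_ite.1 (orthonormal_basisFun (d := d)),
      fun l => (hk l).symm]
  · simp [tsum_eq_zero_of_not_summable hc, fourierCoef_eq_inner]

/-- A divergent series has `tsum` zero, so the upper bound needs no convergence. This is why the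
heat semigroup and the Helmholtz projection are estimated without any summability check. -/
theorem enorm_fourierCoef_tsum_le {ι : Type*} {g : ι → Fin d → ℤ} (hg : Function.Injective g)
    (c : ι → ℂ) (l : ι) :
    ‖fourierCoef (∑' l, c l • basisFun (g l)) (g l)‖ₑ ≤ ‖c l‖ₑ := by
  by_cases hc : Summable fun l => c l • basisFun (g l)
  · rw [fourierCoef_tsum_eq_of_summable hg hc]
  · simp [tsum_eq_zero_of_not_summable hc, fourierCoef_eq_inner]

theorem summable_smul_basisFun {c : (Fin d → ℤ) → ℂ} (hc : ∑' l, ‖c l‖ₑ ^ 2 ≠ ∞) :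
    Summable fun l => c l • basisFun l := by
  have h : Summable fun l => ‖c l‖ ^ 2 := by
    have := ENNReal.summable_toReal hc
    simpa using this
  have := (torusFourierBasis d).hasSum_repr_symm ⟨c,
    (memℓp_gen_iff (by norm_num)).2 (by simpa using h)⟩
  simpa [torusFourierBasis_apply] using this.summable

/-! ### Energy of vector fields, mode by mode. -/

theorem enorm_sq_vectorField (X : VectorField d) : ‖X‖ₑ ^ 2 = ∑ m, ‖X m‖ₑ ^ 2 := by
  have h := PiLp.norm_sq_eq_of_L2 _ X
  have h2 := congrArg ENNReal.ofReal h
  rw [ENNReal.ofReal_sum_of_nonneg (fun _ _ => by positivity)] at h2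
  simpa [ENNReal.ofReal_pow, ofReal_norm] using h2

/-- The squared modulus of the vector of `l`-th Fourier coefficients. -/
noncomputable def coefSq (X : VectorField d) (l : Fin d → ℤ) : ℝ≥0∞ :=
  ∑ m, ‖fourierCoef (X m) l‖ₑ ^ 2

theorem continuous_coefSq (l : Fin d → ℤ) : Continuous fun X : VectorField d => coefSq X l := by
  unfold coefSq
  refine continuous_finsetSum _ fun m _ => ?_
  refine (ENNReal.continuous_pow 2).comp (continuous_enorm.comp ?_)
  exact (continuous_fourierCoef l).comp (PiLp.continuous_apply 2 _ m)

theorem enorm_sq_eq_tsum_coefSq (X : VectorField d) : ‖X‖ₑ ^ 2 = ∑' l, coefSq X l := by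
  rw [enorm_sq_vectorField]
  simp only [coefSq, enorm_sq_eq_tsum_fourierCoef]
  rw [Summable.tsum_finsetSum fun _ _ => ENNReal.summable]

theorem gradNormSq_eq_tsum_coefSq (X : VectorField d) :
    gradNormSq X = ∑' l, ENNReal.ofReal (4 * Real.pi ^ 2 * freqSq l) * coefSq X l := by
  simp only [gradNormSq, coefSq, Finset.mul_sum]
  rw [Summable.tsum_finsetSum fun _ _ => ENNReal.summable]

theorem measurable_coefSq_comp {A : Type*} [MeasurableSpace A] {g : A → VectorField d}
    (hg : StronglyMeasurable g) (l : Fin d → ℤ) : Measurable fun x => coefSq (g x) l :=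
  ((continuous_coefSq l).comp_stronglyMeasurable hg).measurable

theorem measurable_gradNormSq_comp {A : Type*} [MeasurableSpace A] {g : A → VectorField d}
    (hg : StronglyMeasurable g) : Measurable fun x => gradNormSq (g x) := by
  simp only [gradNormSq_eq_tsum_coefSq]
  exact Measurable.tsum fun l => (measurable_coefSq_comp hg l).const_mul _

/-! ### Heat semigroup and Helmholtz projection on Fourier coefficients. -/

theorem enorm_sq_heat_le (τ : ℝ) (X : VectorField d) :
    ‖heat τ X‖ₑ ^ 2 ≤
      ∑' l, ENNReal.ofReal (Real.exp (-(2 * (4 * Real.pi ^ 2 * freqSq l) * τ))) * coefSq X l := by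
  rw [enorm_sq_eq_tsum_coefSq]
  refine ENNReal.tsum_le_tsum fun l => ?_
  rw [coefSq, coefSq, Finset.mul_sum]
  refine Finset.sum_le_sum fun m _ => ?_
  refine (pow_le_pow_left' (enorm_fourierCoef_tsum_le (g := id) Function.injective_id _ l) 2).trans ?_
  rw [enorm_mul, mul_pow]
  gcongr
  rw [← ofReal_norm, ← ENNReal.ofReal_pow (norm_nonneg _), Complex.norm_real,
    Real.norm_of_nonneg (Real.exp_nonneg _), ← Real.exp_nat_mul]
  apply le_of_eq; congr 2; push_cast; ring

theorem freqSq_pos {l : Fin d → ℤ} (hl : l ≠ 0) : 0 < freqSq l := by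
  obtain ⟨i, hi⟩ := Function.ne_iff.1 hl
  refine Finset.sum_pos' (fun _ _ => by positivity) ⟨i, Finset.mem_univ _, ?_⟩
  have : (l i : ℝ) ≠ 0 := by exact_mod_cast hi
  positivity

theorem freqSq_nonneg (l : Fin d → ℤ) : 0 ≤ freqSq l :=
  Finset.sum_nonneg fun _ _ => by positivity

/-- Pythagoras: removing the component of x along n lowers the squared norm by exactly S²/q. -/
theorem sum_sq_sub_proj_le {ι : Type*} (s : Finset ι) (n x : ι → ℝ) {q : ℝ} (hq : 0 < q)
    (hnq : ∑ m ∈ s, n m ^ 2 = q) :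
    ∑ m ∈ s, (x m - n m * (∑ j ∈ s, n j * x j) / q) ^ 2 ≤ ∑ m ∈ s, x m ^ 2 := by
  set S := ∑ j ∈ s, n j * x j with hS
  have : ∑ m ∈ s, (x m - n m * S / q) ^ 2 = ∑ m ∈ s, x m ^ 2 - S ^ 2 / q := by
    have : ∀ m, (x m - n m * S / q) ^ 2 = x m ^ 2 - 2 * (S / q) * (n m * x m)
        + (S / q) ^ 2 * n m ^ 2 := fun m => by ring
    simp only [this, Finset.sum_add_distrib, Finset.sum_sub_distrib, ← Finset.mul_sum, hnq, ← hS]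
    field_simp
    ring
  rw [this]
  have : 0 ≤ S ^ 2 / q := by positivity
  linarith

/-- The projection matrix is real, so it acts on real and imaginary parts separately. -/
theorem sum_enorm_sq_leray_le {l : Fin d → ℤ} (hl : l ≠ 0) (v : Fin d → ℂ) :
    ∑ m, ‖v m - (l m : ℂ) * (∑ j, (l j : ℂ) * v j) / (freqSq l : ℂ)‖ₑ ^ 2 ≤ ∑ m, ‖v m‖ₑ ^ 2 := by
  have hq := freqSq_pos hl
  have key : ∑ m, ‖v m - (l m : ℂ) * (∑ j, (l j : ℂ) * v j) / (freqSq l : ℂ)‖ ^ 2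
      ≤ ∑ m, ‖v m‖ ^ 2 := by
    have hsq : ∀ z : ℂ, ‖z‖ ^ 2 = z.re ^ 2 + z.im ^ 2 := fun z => by
      rw [← Complex.normSq_eq_norm_sq, Complex.normSq_apply]; ring
    simp only [hsq, Finset.sum_add_distrib]
    have hre := sum_sq_sub_proj_le Finset.univ (fun j => (l j : ℝ)) (fun j => (v j).re) hq rfl
    have him := sum_sq_sub_proj_le Finset.univ (fun j => (l j : ℝ)) (fun j => (v j).im) hq rfl
    refine add_le_add (le_of_eq_of_le ?_ hre) (le_of_eq_of_le ?_ him)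
    · refine Finset.sum_congr rfl fun m _ => ?_
      simp [Complex.div_ofReal_re, Complex.re_sum]
    · refine Finset.sum_congr rfl fun m _ => ?_
      simp [Complex.div_ofReal_im, Complex.im_sum]
  have := ENNReal.ofReal_le_ofReal key
  rw [ENNReal.ofReal_sum_of_nonneg (fun _ _ => by positivity),
    ENNReal.ofReal_sum_of_nonneg (fun _ _ => by positivity)] at this
  simpa [ENNReal.ofReal_pow, ofReal_norm] using this

theorem coefSq_helmholtz_le (X : VectorField d) (l : Fin d → ℤ) :
    coefSq (helmholtz X) l ≤ coefSq X l := by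
  by_cases hl : l = 0
  · have : coefSq (helmholtz X) l = 0 := by
      refine Finset.sum_eq_zero fun m _ => ?_
      have := fourierCoef_tsum_eq_zero (g := fun l : NonzeroFreq d => l.1) (k := l)
        (fun l : NonzeroFreq d => fourierCoef (X m) l.1 -
          (l.1 m : ℂ) * (∑ j, (l.1 j : ℂ) * fourierCoef (X j) l.1) / (freqSq l.1 : ℂ))
        (fun l' => hl ▸ l'.2)
      simp only [helmholtz, this]
      simp
    simp [this]
  · refine le_trans (Finset.sum_le_sum fun m _ => pow_le_pow_left'
      (enorm_fourierCoef_tsum_le (g := fun l : NonzeroFreq d => l.1) Subtype.val_injective _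
        ⟨l, hl⟩) 2) ?_
    exact sum_enorm_sq_leray_le hl fun m => fourierCoef (X m) l

/-! ### The transport term in Fourier variables. -/

theorem fourierCoef_mulBasis (k l : Fin d → ℤ) (u : ScalarField d) :
    fourierCoef (mulBasis k u) l = fourierCoef u (l - k) := by
  unfold fourierCoef mulBasis
  refine integral_congr_ae ?_
  filter_upwards [Lp.coeFn_lpSMul (r := 2) (ContinuousMap.toLp (E := ℂ) ∞ (torusMeasure d) ℂ
      (UnitAddTorus.mFourier k) : Lp ℂ ∞ (torusMeasure d)) u,
    ContinuousMap.coeFn_toLp (p := ∞) (𝕜 := ℂ) (torusMeasure d) (UnitAddTorus.mFourier k)]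
    with x h1 h2
  rw [h1, Pi.smul_apply', h2, smul_eq_mul, ← mul_assoc, ← UnitAddTorus.mFourier_add]
  congr 3
  abel

/-- An exact identity, so the series must converge here; convergence follows from |lⱼ|² ≤ |l|² and
the finite gradient norm. -/
theorem fourierCoef_partialDeriv {u : VectorField d} (hu : gradNormSq u ≠ ∞) (j m : Fin d)
    (l : Fin d → ℤ) :
    fourierCoef (partialDeriv j (u m)) l =
      2 * Real.pi * Complex.I * (l j : ℂ) * fourierCoef (u m) l := by
  refine fourierCoef_tsum_eq_of_summable (g := id) Function.injective_id
    (summable_smul_basisFun (ne_top_of_le_ne_top hu ?_)) l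
  refine le_trans (ENNReal.tsum_le_tsum fun l => ?_)
    (Finset.single_le_sum (f := fun m => ∑' l : Fin d → ℤ,
      ENNReal.ofReal (4 * Real.pi ^ 2 * freqSq l) * ‖fourierCoef (u m) l‖ₑ ^ 2)
      (fun _ _ => zero_le) (Finset.mem_univ m))
  rw [enorm_mul, mul_pow]
  gcongr
  rw [← ofReal_norm, ← ENNReal.ofReal_pow (norm_nonneg _)]
  refine ENNReal.ofReal_le_ofReal ?_
  have h1 : (l j : ℝ) ^ 2 ≤ freqSq l :=
    Finset.single_le_sum (f := fun j => (l j : ℝ) ^ 2) (fun _ _ => by positivity)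
      (Finset.mem_univ j)
  have h2 : ‖(2 * Real.pi * Complex.I * (l j : ℂ))‖ ^ 2 = 4 * Real.pi ^ 2 * (l j : ℝ) ^ 2 := by
    simp only [norm_mul, Complex.norm_real, Complex.norm_I, mul_pow, Complex.norm_intCast,
      Real.norm_eq_abs, sq_abs]
    norm_num
  rw [h2]
  gcongr

theorem coefSq_transport {u : VectorField d} (hu : gradNormSq u ≠ ∞) {k : Fin d → ℤ}
    {a : EuclideanSpace ℝ (Fin d)} (ha : ∑ j, a j * (k j : ℝ) = 0) (l : Fin d → ℤ) :
    coefSq (transport k a u) l =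
      ENNReal.ofReal (4 * Real.pi ^ 2 * (∑ j, a j * (l j : ℝ)) ^ 2) * coefSq u (l - k) := by
  rw [coefSq, coefSq, Finset.mul_sum]
  refine Finset.sum_congr rfl fun m _ => ?_
  have h : fourierCoef (transport k a u m) l =
      (2 * Real.pi * Complex.I * ((∑ j, a j * (l j : ℝ) : ℝ) : ℂ)) * fourierCoef (u m) (l - k) := by
    -- The field a e_k is divergence free, so the derivative symbol is the same at the input
    -- frequency l-k and at the output frequency l.
    have h0 : ∑ j, a j * (l j : ℝ) = ∑ j, a j * ((l - k) j : ℝ) := by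
      simp [mul_sub, Finset.sum_sub_distrib, ha]
    rw [h0]
    simp only [transport, fourierCoef_sum_smul, fourierCoef_mulBasis, fourierCoef_partialDeriv hu]
    push_cast
    rw [Finset.mul_sum, Finset.sum_mul]
    exact Finset.sum_congr rfl fun j _ => by ring
  rw [h, enorm_mul, mul_pow]
  congr 1
  rw [← ofReal_norm, ← ENNReal.ofReal_pow (norm_nonneg _)]
  congr 1
  simp only [norm_mul, Complex.norm_real, Complex.norm_I, mul_pow, Real.norm_eq_abs, sq_abs]
  norm_num

/-- The squared `L²` norm of the integrand of the stochastic convolution is at most this. -/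
noncomputable def convBound (k : Fin d → ℤ) (a : EuclideanSpace ℝ (Fin d)) (τ : ℝ)
    (u : VectorField d) : ℝ≥0∞ :=
  ∑' l, ENNReal.ofReal (Real.exp (-(2 * (4 * Real.pi ^ 2 * freqSq l) * τ))) *
    (ENNReal.ofReal (4 * Real.pi ^ 2 * (∑ j, a j * (l j : ℝ)) ^ 2) * coefSq u (l - k))

theorem enorm_sq_heat_helmholtz_transport_le {u : VectorField d} (hu : gradNormSq u ≠ ∞)
    {k : Fin d → ℤ} {a : EuclideanSpace ℝ (Fin d)} (ha : ∑ j, a j * (k j : ℝ) = 0) (τ : ℝ) :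
    ‖heat τ (helmholtz (transport k a u))‖ₑ ^ 2 ≤ convBound k a τ u := by
  refine (enorm_sq_heat_le τ _).trans (ENNReal.tsum_le_tsum fun l => ?_)
  gcongr
  rw [← coefSq_transport hu ha]
  exact coefSq_helmholtz_le _ _

end TransportNoise

namespace TransportNoise

/-! ### Simple processes on a common grid -/

/-- Enumerate T in increasing order and stay at the last point forever. The final clause says that
no point of T lies strictly inside a grid cell. -/
theorem exists_grid (T : Finset ℝ≥0) (hT : T.Nonempty) :
    ∃ (M : ℕ) (t : ℕ → ℝ≥0), Monotone t ∧ (∀ j, t j ∈ T) ∧ (∀ x ∈ T, t 0 ≤ x ∧ x ≤ t M) ∧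
      ∀ x ∈ T, ∀ j, x < t (j + 1) → x ≤ t j := by
  have hc : 0 < T.card := hT.card_pos
  let e := T.orderEmbOfFin rfl
  have he : ∀ x ∈ T, ∃ i, e i = x := fun x hx => by
    have : x ∈ Set.range e := by rw [Finset.range_orderEmbOfFin]; exact hx
    exact this
  refine ⟨T.card - 1, fun j => e ⟨min j (T.card - 1), by omega⟩, ?_, ?_, ?_, ?_⟩
  · intro i j hij
    exact e.monotone (Fin.mk_le_mk.2 (by omega))
  · exact fun j => Finset.orderEmbOfFin_mem _ _ _
  · intro x hx
    obtain ⟨i, rfl⟩ := he x hx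
    exact ⟨e.monotone (Fin.le_def.2 (by simp)), e.monotone (Fin.le_def.2 (by simp; omega))⟩
  · intro x hx j hj
    obtain ⟨i, rfl⟩ := he x hx
    have := Fin.lt_def.1 (e.lt_iff_lt.1 hj)
    exact e.monotone (Fin.le_def.2 (by simp at this ⊢; omega))

variable {Ω : Type*} [mΩ : MeasurableSpace Ω] {𝓕 : Filtration ℝ≥0 mΩ} {P : Measure Ω}

section Grid

variable {E : Type*} [NormedAddCommGroup E]

/-- The nodes of the simple process `X` lie on the grid `t 0 ≤ t 1 ≤ ... ≤ t M`. -/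
structure SimpleProcess.OnGrid (X : SimpleProcess 𝓕 E) (t : ℕ → ℝ≥0) (M : ℕ) : Prop where
  mono : Monotone t
  zero_le : ∀ i ≤ X.N, t 0 ≤ X.τ i
  le_last : ∀ i ≤ X.N, X.τ i ≤ t M
  step : ∀ i ≤ X.N, ∀ j, X.τ i < t (j + 1) → X.τ i ≤ t j

theorem SimpleProcess.OnGrid.val_eq {X : SimpleProcess 𝓕 E} {t : ℕ → ℝ≥0} {M : ℕ}
    (h : X.OnGrid t M) {j : ℕ} {r : ℝ≥0} (hr : r ∈ Set.Ioc (t j) (t (j + 1))) :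
    X.val r = X.val (t (j + 1)) := by
  classical
  funext ω
  refine Finset.sum_congr rfl fun i hi => ?_
  have hi := Finset.mem_range.1 hi
  have h1 : ∀ i ≤ X.N, (X.τ i < r ↔ X.τ i < t (j + 1)) := fun i hi =>
    ⟨fun h' => h'.trans_le hr.2, fun h' => (h.step i hi j h').trans_lt hr.1⟩
  have h2 : r ≤ X.τ (i + 1) ↔ t (j + 1) ≤ X.τ (i + 1) := by
    rw [← not_lt, h1 (i + 1) hi, not_lt]
  simp only [Set.indicator_apply, Set.mem_Ioc, h1 i hi.le, h2]

theorem SimpleProcess.OnGrid.integral_eq [NormedSpace ℂ E] {X : SimpleProcess 𝓕 E} {t : ℕ → ℝ≥0}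
    {M : ℕ} (h : X.OnGrid t M) (w : ℝ≥0 → Ω → ℂ) (ω : Ω) :
    X.integral w ω = ∑ j ∈ Finset.range M, (w (t (j + 1)) ω - w (t j) ω) • X.val (t (j + 1)) ω := by
  classical
  simp only [SimpleProcess.integral, SimpleProcess.val, Finset.smul_sum]
  rw [Finset.sum_comm]
  refine Finset.sum_congr rfl fun i hi => ?_
  have hi := Finset.mem_range.1 hi
  have hτ : X.τ i ≤ X.τ (i + 1) := X.τ_mono (Nat.le_succ i)
  -- Clamping the grid to [τ i, τ (i+1)] turns the cells inside this interval into a telescoping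
  -- sum, while cells outside contribute zero.
  let c : ℝ≥0 → ℝ≥0 := fun x => max (X.τ i) (min x (X.τ (i + 1)))
  have key : ∀ j, (w (t (j + 1)) ω - w (t j) ω) •
      (Set.Ioc (X.τ i) (X.τ (i + 1))).indicator (fun _ => X.ξ i ω) (t (j + 1)) =
      (w (c (t (j + 1))) ω - w (c (t j)) ω) • X.ξ i ω := by
    intro j
    have hj := h.mono (Nat.le_succ j)
    by_cases h1 : X.τ i < t (j + 1)
    · by_cases h2 : t (j + 1) ≤ X.τ (i + 1)
      · rw [Set.indicator_of_mem (Set.mem_Ioc.2 ⟨h1, h2⟩)]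
        have h3 := h.step i hi.le j h1
        simp only [c]
        rw [min_eq_left h2, max_eq_right h1.le, min_eq_left (hj.trans h2), max_eq_right h3]
      · rw [Set.indicator_of_notMem fun hm => h2 hm.2]
        have h3 := h.step (i + 1) hi j (not_le.1 h2)
        simp only [c]
        rw [min_eq_right (not_le.1 h2).le, min_eq_right h3]
        simp
    · rw [Set.indicator_of_notMem fun hm => h1 hm.1]
      have h1 := not_lt.1 h1
      simp only [c]
      rw [max_eq_left ((min_le_left _ _).trans h1), max_eq_left ((min_le_left _ _).trans
        (hj.trans h1))]
      simp
  simp only [key]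
  rw [← Finset.sum_smul, Finset.sum_range_sub fun j => w (c (t j)) ω]
  congr 3
  · simp only [c]
    rw [min_eq_right (h.le_last _ hi), max_eq_right hτ]
  · simp only [c]
    rw [max_eq_left ((min_le_left _ _).trans (h.zero_le _ hi.le))]

/-- If interval i contains the right end of a cell, then τ i is at or before its left end. The value
on the cell is therefore known at the left end, which the isometry requires. -/
theorem SimpleProcess.OnGrid.stronglyMeasurable_val {X : SimpleProcess 𝓕 E} {t : ℕ → ℝ≥0} {M : ℕ}
    (h : X.OnGrid t M) (j : ℕ) : StronglyMeasurable[𝓕 (t j)] (X.val (t (j + 1))) := by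
  classical
  unfold SimpleProcess.val
  refine Finset.stronglyMeasurable_fun_sum _ fun i hi => ?_
  have hi := Finset.mem_range.1 hi
  simp only [Set.indicator_apply, Set.mem_Ioc]
  split_ifs with hm
  · exact (X.ξ_meas i).mono (𝓕.mono (h.step i hi.le j hm.1))
  · exact stronglyMeasurable_const

theorem SimpleProcess.exists_bound_val (X : SimpleProcess 𝓕 E) (r : ℝ≥0) :
    ∃ C : ℝ, ∀ ω, ‖X.val r ω‖ ≤ C := by
  classical
  choose C hC using X.ξ_bdd
  refine ⟨∑ i ∈ Finset.range X.N, C i, fun ω => norm_sum_le_of_le _ fun i _ => ?_⟩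
  exact (norm_indicator_le_norm_self _ _).trans (hC i ω)

/-- The process is constant on each cell and the cells are disjoint subsets of (a, b]; they need not
fill it, hence only an inequality. -/
theorem SimpleProcess.OnGrid.sum_lintegral_val_le {X : SimpleProcess 𝓕 E} {t : ℕ → ℝ≥0} {M : ℕ}
    (h : X.OnGrid t M) {a b : ℝ≥0} (hab : ∀ j, t j ∈ Set.Icc a b) :
    ∑ j ∈ Finset.range M, ENNReal.ofReal ((t (j + 1) : ℝ) - t j) *
        ∫⁻ ω, ‖X.val (t (j + 1)) ω‖ₑ ^ 2 ∂P ≤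
      ∫⁻ r in Set.Ioc (a : ℝ) b, ∫⁻ ω, ‖X.val r.toNNReal ω‖ₑ ^ 2 ∂P := by
  have hmono : Monotone fun j => (t j : ℝ) := fun i j hij => by exact_mod_cast h.mono hij
  have heq : ∀ j, ENNReal.ofReal ((t (j + 1) : ℝ) - t j) * ∫⁻ ω, ‖X.val (t (j + 1)) ω‖ₑ ^ 2 ∂P =
      ∫⁻ r in Set.Ioc (t j : ℝ) (t (j + 1)), ∫⁻ ω, ‖X.val r.toNNReal ω‖ₑ ^ 2 ∂P := by
    intro j
    rw [setLIntegral_congr_fun (g := fun _ => ∫⁻ ω, ‖X.val (t (j + 1)) ω‖ₑ ^ 2 ∂P)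
      measurableSet_Ioc]
    · rw [setLIntegral_const, Real.volume_Ioc, mul_comm]
    · intro r hr
      have : r.toNNReal ∈ Set.Ioc (t j) (t (j + 1)) :=
        ⟨Real.lt_toNNReal_iff_coe_lt.2 hr.1, Real.toNNReal_le_iff_le_coe.2 hr.2⟩
      simp only [h.val_eq this]
  simp only [heq]
  rw [← lintegral_biUnion_finset]
  · refine lintegral_mono_set (Set.iUnion₂_subset fun j _ => Set.Ioc_subset_Ioc ?_ ?_)
    · exact_mod_cast (hab j).1
    · exact_mod_cast (hab (j + 1)).2
  · intro i _ j _ hij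
    simpa using hmono.pairwise_disjoint_on_Ioc_succ hij
  · exact fun _ _ => measurableSet_Ioc

end Grid

/-! ### The Itô isometry -/

/-- Square integrable complex noises with centred, mutually uncorrelated increments that are
independent of the past. -/
structure IsOrthogonalNoise {ι : Type*} [DecidableEq ι] (𝓕 : Filtration ℝ≥0 mΩ) (P : Measure Ω)
    (W : ι → ℝ≥0 → Ω → ℂ) : Prop where
  adapted : ∀ p, StronglyAdapted 𝓕 (W p)
  memLp : ∀ p s t, MemLp (fun ω => W p t ω - W p s ω) 2 P
  mean : ∀ p s t, ∫ ω, (W p t ω - W p s ω) ∂P = 0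
  cov : ∀ p q s t, s ≤ t → ∫ ω, conj (W p t ω - W p s ω) * (W q t ω - W q s ω) ∂P =
    if p = q then ((2 * ((t : ℝ) - s) : ℝ) : ℂ) else 0
  indep : ∀ s t, s ≤ t → Indep (MeasurableSpace.comap (fun ω p => W p t ω - W p s ω)
    MeasurableSpace.pi) (𝓕 s) P

variable {E : Type*} [NormedAddCommGroup E] [InnerProductSpace ℂ E]

theorem memLp_two_integrable_inner {f g : Ω → E} (hf : MemLp f 2 P) (hg : MemLp g 2 P) :
    Integrable (fun ω => inner ℂ (f ω) (g ω)) P := by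
  refine (hf.norm.integrable_mul hg.norm).mono' (hf.1.inner hg.1) (ae_of_all _ fun ω => ?_)
  exact norm_inner_le_norm _ _

theorem integral_norm_sq_sum_of_orthogonal {A : Type*} [DecidableEq A] (s : Finset A)
    {U : A → Ω → E} (hU : ∀ a ∈ s, MemLp (U a) 2 P)
    (ho : ∀ a ∈ s, ∀ b ∈ s, a ≠ b → ∫ ω, inner ℂ (U a ω) (U b ω) ∂P = 0) :
    ∫ ω, ‖∑ a ∈ s, U a ω‖ ^ 2 ∂P = ∑ a ∈ s, ∫ ω, ‖U a ω‖ ^ 2 ∂P := by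
  have h1 : ∀ x : E, ((‖x‖ ^ 2 : ℝ) : ℂ) = inner ℂ x x := fun x => by
    rw [inner_self_eq_norm_sq_to_K]; simp
  have h2 : ((∫ ω, ‖∑ a ∈ s, U a ω‖ ^ 2 ∂P : ℝ) : ℂ) = ((∑ a ∈ s, ∫ ω, ‖U a ω‖ ^ 2 ∂P : ℝ) : ℂ) := by
    rw [Complex.ofReal_sum]
    simp only [← integral_complex_ofReal, h1, sum_inner]
    simp only [inner_sum]
    rw [integral_finsetSum _ fun a ha => integrable_finsetSum _ fun b hb =>
      memLp_two_integrable_inner (hU a ha) (hU b hb)]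
    refine Finset.sum_congr rfl fun a ha => ?_
    rw [integral_finsetSum _ fun b hb => memLp_two_integrable_inner (hU a ha) (hU b hb)]
    rw [Finset.sum_eq_single a]
    · exact fun b hb hba => ho a ha b hb hba.symm
    · exact fun h => absurd ha h
  exact_mod_cast h2

theorem lintegral_enorm_sq_eq_ofReal {F : Type*} [NormedAddCommGroup F] {f : Ω → F}
    (hf : MemLp f 2 P) :
    ∫⁻ ω, ‖f ω‖ₑ ^ 2 ∂P = ENNReal.ofReal (∫ ω, ‖f ω‖ ^ 2 ∂P) := by
  rw [ofReal_integral_eq_lintegral_ofReal (hf.integrable_norm_pow (by norm_num))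
    (ae_of_all _ fun _ => by positivity)]
  simp only [ENNReal.ofReal_pow (norm_nonneg _), ofReal_norm]

namespace IsOrthogonalNoise

variable {ι : Type*} [DecidableEq ι] {W : ι → ℝ≥0 → Ω → ℂ}

theorem memLp_smul (hW : IsOrthogonalNoise 𝓕 P W) [IsProbabilityMeasure P] (p : ι) (s t : ℝ≥0)
    {η : Ω → E} (hη : AEStronglyMeasurable η P) {C : ℝ} (hC : ∀ ω, ‖η ω‖ ≤ C) :
    MemLp (fun ω => (W p t ω - W p s ω) • η ω) 2 P :=
  (memLp_top_of_bound hη C (ae_of_all _ hC)).smul (hW.memLp p s t)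

theorem indepFun_of_past (hW : IsOrthogonalNoise 𝓕 P W) {s t : ℝ≥0} (hst : s ≤ t)
    {g : (ι → ℂ) → ℂ} (hg : Measurable g) {Y : Ω → ℂ} (hY : StronglyMeasurable[𝓕 s] Y) :
    IndepFun (fun ω => g fun p => W p t ω - W p s ω) Y P := by
  rw [IndepFun_iff_Indep]
  refine indep_of_indep_of_le (hW.indep s t hst) ?_ hY.measurable.comap_le
  rw [show (fun ω => g fun p => W p t ω - W p s ω) = g ∘ fun ω p => W p t ω - W p s ω from rfl,
    ← MeasurableSpace.comap_comp]
  exact MeasurableSpace.comap_mono hg.comap_le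

/-- The inner product is the increment times a quantity known at time s; independence factors the
expectation and the increment has mean zero. -/
theorem integral_inner_past_eq_zero (hW : IsOrthogonalNoise 𝓕 P W) (p : ι) {s t : ℝ≥0}
    (hst : s ≤ t) {A η : Ω → E} (hA : StronglyMeasurable[𝓕 s] A)
    (hη : StronglyMeasurable[𝓕 s] η) :
    ∫ ω, inner ℂ (A ω) ((W p t ω - W p s ω) • η ω) ∂P = 0 := by
  have hY : StronglyMeasurable[𝓕 s] fun ω => inner ℂ (A ω) (η ω) := hA.inner hη
  have hi := hW.indepFun_of_past hst (measurable_pi_apply p) hY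
  simp only [inner_smul_right]
  rw [hi.integral_fun_mul_eq_mul_integral (hW.memLp p s t).1
    (hY.mono (𝓕.le s)).aestronglyMeasurable, hW.mean, zero_mul]

theorem integral_inner_same (hW : IsOrthogonalNoise 𝓕 P W) (p q : ι) {s t : ℝ≥0}
    (hst : s ≤ t) {A η : Ω → E} (hA : StronglyMeasurable[𝓕 s] A)
    (hη : StronglyMeasurable[𝓕 s] η) :
    ∫ ω, inner ℂ ((W p t ω - W p s ω) • A ω) ((W q t ω - W q s ω) • η ω) ∂P =
      (if p = q then ((2 * ((t : ℝ) - s) : ℝ) : ℂ) else 0) * ∫ ω, inner ℂ (A ω) (η ω) ∂P := by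
  have hY : StronglyMeasurable[𝓕 s] fun ω => inner ℂ (A ω) (η ω) := hA.inner hη
  have hi := hW.indepFun_of_past hst (g := fun x => conj (x p) * x q)
    ((Complex.continuous_conj.measurable.comp (measurable_pi_apply p)).mul
      (measurable_pi_apply q)) hY
  simp only [inner_smul_right, inner_smul_left]
  rw [← hW.cov p q s t hst, ← hi.integral_fun_mul_eq_mul_integral _
    (hY.mono (𝓕.le s)).aestronglyMeasurable]
  · refine integral_congr_ae (ae_of_all _ fun ω => ?_)
    simp only
    ring
  · exact (Complex.continuous_conj.comp_aestronglyMeasurable (hW.memLp p s t).1).mul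
      (hW.memLp q s t).1

theorem lintegral_enorm_sq_smul (hW : IsOrthogonalNoise 𝓕 P W) [IsProbabilityMeasure P] (p : ι)
    {s t : ℝ≥0} (hst : s ≤ t) {η : Ω → E} (hη : StronglyMeasurable[𝓕 s] η) {C : ℝ}
    (hC : ∀ ω, ‖η ω‖ ≤ C) :
    ∫⁻ ω, ‖(W p t ω - W p s ω) • η ω‖ₑ ^ 2 ∂P =
      ENNReal.ofReal (2 * ((t : ℝ) - s)) * ∫⁻ ω, ‖η ω‖ₑ ^ 2 ∂P := by
  have hm := (hη.mono (𝓕.le s)).aestronglyMeasurable (μ := P)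
  have h0 : (0 : ℝ) ≤ t - s := sub_nonneg.2 (by exact_mod_cast hst)
  rw [lintegral_enorm_sq_eq_ofReal (hW.memLp_smul p s t hm hC),
    lintegral_enorm_sq_eq_ofReal (MemLp.of_bound hm C (ae_of_all _ hC)),
    ← ENNReal.ofReal_mul (by positivity)]
  congr 1
  have h := hW.integral_inner_same p p hst hη hη
  simp only [inner_self_eq_norm_sq_to_K, if_true] at h
  have h1 : ∀ x : ℝ, ((x : ℂ)) ^ 2 = ((x ^ 2 : ℝ) : ℂ) := fun x => by push_cast; rfl
  simp only [Complex.coe_algebraMap, h1, integral_complex_ofReal] at h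
  exact_mod_cast h

/-- Each pair of a mode and a grid cell gives one term, and these terms are pairwise orthogonal in
L²(Ω; E). Treating all modes at once keeps the constant independent of the number of modes. -/
theorem lintegral_enorm_sq_sum_integral_le_of_onGrid (hW : IsOrthogonalNoise 𝓕 P W)
    [IsProbabilityMeasure P] (S : Finset ι) (c : ι → ℂ) (X : ι → SimpleProcess 𝓕 E) {a b : ℝ≥0}
    {t : ℕ → ℝ≥0} {M : ℕ} (hmono : Monotone t) (hgrid : ∀ p ∈ S, (X p).OnGrid t M)
    (htab : ∀ j, t j ∈ Set.Icc a b) :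
    ∫⁻ ω, ‖∑ p ∈ S, c p • (X p).integral (W p) ω‖ₑ ^ 2 ∂P ≤
      ∑ p ∈ S, 2 * ‖c p‖ₑ ^ 2 *
        ∫⁻ r in Set.Ioc (a : ℝ) b, ∫⁻ ω, ‖(X p).val r.toNNReal ω‖ₑ ^ 2 ∂P := by
  let U : ι × ℕ → Ω → E := fun q ω =>
    (W q.1 (t (q.2 + 1)) ω - W q.1 (t q.2) ω) • (c q.1 • (X q.1).val (t (q.2 + 1)) ω)
  have hη : ∀ p ∈ S, ∀ j, StronglyMeasurable[𝓕 (t j)]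
      fun ω => c p • (X p).val (t (j + 1)) ω := fun p hp j =>
    ((hgrid p hp).stronglyMeasurable_val j).const_smul (c p)
  have hUL : ∀ q ∈ S ×ˢ Finset.range M, MemLp (U q) 2 P := by
    intro q hq
    have hq := Finset.mem_product.1 hq
    obtain ⟨C, hC⟩ := (X q.1).exists_bound_val (t (q.2 + 1))
    refine hW.memLp_smul q.1 _ _ ((hη q.1 hq.1 q.2).mono (𝓕.le _)).aestronglyMeasurable
      (C := ‖c q.1‖ * C) fun ω => ?_
    rw [norm_smul]
    exact mul_le_mul_of_nonneg_left (hC ω) (norm_nonneg _)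
  have hUm : ∀ p ∈ S, ∀ j, StronglyMeasurable[𝓕 (t (j + 1))] (U (p, j)) := fun p hp j =>
    ((hW.adapted p _).sub ((hW.adapted p _).mono (𝓕.mono (hmono (Nat.le_succ j))))).smul
      ((hη p hp j).mono (𝓕.mono (hmono (Nat.le_succ j))))
  have hlt : ∀ p ∈ S, ∀ q ∈ S, ∀ i j, i < j →
      ∫ ω, inner ℂ (U (p, i) ω) (U (q, j) ω) ∂P = 0 := fun p hp q hq i j hij =>
    hW.integral_inner_past_eq_zero q (hmono (Nat.le_succ j))
      ((hUm p hp i).mono (𝓕.mono (hmono hij))) (hη q hq j)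
  have ho : ∀ q ∈ S ×ˢ Finset.range M, ∀ q' ∈ S ×ˢ Finset.range M, q ≠ q' →
      ∫ ω, inner ℂ (U q ω) (U q' ω) ∂P = 0 := by
    rintro ⟨p, i⟩ hp ⟨q, j⟩ hq hne
    have hp := (Finset.mem_product.1 hp).1
    have hq := (Finset.mem_product.1 hq).1
    -- In different cells the later increment is centred and independent of the past; in the same
    -- cell distinct modes are uncorrelated. The third case is the conjugate of the first.
    rcases lt_trichotomy i j with h | rfl | h
    · exact hlt p hp q hq i j h
    · have hpq : p ≠ q := fun h => hne (by rw [h])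
      have := hW.integral_inner_same p q (hmono (Nat.le_succ i)) (hη p hp i) (hη q hq i)
      rw [if_neg hpq, zero_mul] at this
      exact this
    · have := congrArg conj (hlt q hq p hp j i h)
      rw [← integral_conj, map_zero] at this
      simpa only [inner_conj_symm] using this
  have hsum : ∀ ω, ∑ p ∈ S, c p • (X p).integral (W p) ω = ∑ q ∈ S ×ˢ Finset.range M, U q ω := by
    intro ω
    rw [Finset.sum_product]
    refine Finset.sum_congr rfl fun p hp => ?_
    rw [(hgrid p hp).integral_eq, Finset.smul_sum]
    exact Finset.sum_congr rfl fun j _ => smul_comm _ _ _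
  have hsq : ∀ p ∈ S, ∀ j, ∫⁻ ω, ‖U (p, j) ω‖ₑ ^ 2 ∂P = 2 * ‖c p‖ₑ ^ 2 *
      (ENNReal.ofReal ((t (j + 1) : ℝ) - t j) * ∫⁻ ω, ‖(X p).val (t (j + 1)) ω‖ₑ ^ 2 ∂P) := by
    intro p hp j
    obtain ⟨C, hC⟩ := (X p).exists_bound_val (t (j + 1))
    have := hW.lintegral_enorm_sq_smul p (hmono (Nat.le_succ j)) (hη p hp j) (C := ‖c p‖ * C)
      fun ω => by
        rw [norm_smul]
        exact mul_le_mul_of_nonneg_left (hC ω) (norm_nonneg _)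
    refine this.trans ?_
    simp only [enorm_smul, mul_pow]
    rw [lintegral_const_mul' _ _ (by simp), ENNReal.ofReal_mul (by norm_num)]
    simp only [ENNReal.ofReal_ofNat]
    ring
  have hmem : MemLp (fun ω => ∑ q ∈ S ×ˢ Finset.range M, U q ω) 2 P := memLp_finsetSum _ hUL
  have hiso : ∫⁻ ω, ‖∑ p ∈ S, c p • (X p).integral (W p) ω‖ₑ ^ 2 ∂P =
      ∑ q ∈ S ×ˢ Finset.range M, ∫⁻ ω, ‖U q ω‖ₑ ^ 2 ∂P := by
    rw [lintegral_congr fun ω => congrArg (fun x => ‖x‖ₑ ^ 2) (hsum ω),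
      lintegral_enorm_sq_eq_ofReal hmem, integral_norm_sq_sum_of_orthogonal _ hUL ho,
      ENNReal.ofReal_sum_of_nonneg fun _ _ => integral_nonneg fun _ => sq_nonneg _]
    exact Finset.sum_congr rfl fun q hq => (lintegral_enorm_sq_eq_ofReal (hUL q hq)).symm
  rw [hiso, Finset.sum_product]
  refine Finset.sum_le_sum fun p hp => ?_
  rw [Finset.sum_congr rfl fun j _ => hsq p hp j, ← Finset.mul_sum]
  gcongr
  exact (hgrid p hp).sum_lintegral_val_le htab

theorem lintegral_enorm_sq_sum_integral_le (hW : IsOrthogonalNoise 𝓕 P W)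
    [IsProbabilityMeasure P] (S : Finset ι) (c : ι → ℂ) (X : ι → SimpleProcess 𝓕 E) {a b : ℝ≥0}
    (hX : ∀ p ∈ S, ∀ i, (X p).τ i ∈ Set.Icc a b) :
    ∫⁻ ω, ‖∑ p ∈ S, c p • (X p).integral (W p) ω‖ₑ ^ 2 ∂P ≤
      ∑ p ∈ S, 2 * ‖c p‖ₑ ^ 2 *
        ∫⁻ r in Set.Ioc (a : ℝ) b, ∫⁻ ω, ‖(X p).val r.toNNReal ω‖ₑ ^ 2 ∂P := by
  classical
  rcases S.eq_empty_or_nonempty with rfl | ⟨p₀, hp₀⟩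
  · simp
  obtain ⟨M, t, hmono, htT, hbd, hstep⟩ := exists_grid
    (S.biUnion fun p => (Finset.range ((X p).N + 1)).image (X p).τ)
    ⟨(X p₀).τ 0, Finset.mem_biUnion.2 ⟨p₀, hp₀, Finset.mem_image.2 ⟨0, by simp, rfl⟩⟩⟩
  have hmem : ∀ p ∈ S, ∀ i ≤ (X p).N,
      (X p).τ i ∈ S.biUnion fun p => (Finset.range ((X p).N + 1)).image (X p).τ :=
    fun p hp i hi => Finset.mem_biUnion.2 ⟨p, hp, Finset.mem_image.2
      ⟨i, Finset.mem_range.2 (by omega), rfl⟩⟩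
  have hgrid : ∀ p ∈ S, (X p).OnGrid t M := fun p hp =>
    { mono := hmono
      zero_le := fun i hi => (hbd _ (hmem p hp i hi)).1
      le_last := fun i hi => (hbd _ (hmem p hp i hi)).2
      step := fun i hi => hstep _ (hmem p hp i hi) }
  have htab : ∀ j, t j ∈ Set.Icc a b := fun j => by
    obtain ⟨p, hp, h⟩ := Finset.mem_biUnion.1 (htT j)
    obtain ⟨i, _, h⟩ := Finset.mem_image.1 h
    exact h ▸ hX p hp i
  exact hW.lintegral_enorm_sq_sum_integral_le_of_onGrid S c X hmono hgrid htab

end IsOrthogonalNoise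

end TransportNoise

namespace TransportNoise

/-! ### From simple integrands to Itô integrals. -/

theorem enorm_sq_add_le {E : Type*} [SeminormedAddCommGroup E] (x y : E) :
    ‖x + y‖ₑ ^ 2 ≤ 2 * ‖x‖ₑ ^ 2 + 2 * ‖y‖ₑ ^ 2 := by
  have h : ‖x + y‖ ^ 2 ≤ 2 * ‖x‖ ^ 2 + 2 * ‖y‖ ^ 2 := by
    have := norm_add_le x y
    nlinarith [norm_nonneg (x + y), norm_nonneg x, norm_nonneg y, sq_nonneg (‖x‖ - ‖y‖)]
  have h2 := ENNReal.ofReal_le_ofReal h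
  rw [ENNReal.ofReal_add (by positivity) (by positivity), ENNReal.ofReal_mul (by norm_num),
    ENNReal.ofReal_mul (by norm_num)] at h2
  simpa [ENNReal.ofReal_pow, ofReal_norm] using h2

theorem enorm_sq_sum_le {E A : Type*} [SeminormedAddCommGroup E] (s : Finset A) (v : A → E) :
    ‖∑ a ∈ s, v a‖ₑ ^ 2 ≤ s.card * ∑ a ∈ s, ‖v a‖ₑ ^ 2 := by
  have h : ‖∑ a ∈ s, v a‖ ^ 2 ≤ s.card * ∑ a ∈ s, ‖v a‖ ^ 2 :=
    (pow_le_pow_left₀ (norm_nonneg _) (norm_sum_le _ _) 2).trans (sq_sum_le_card_mul_sum_sq)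
  have h2 := ENNReal.ofReal_le_ofReal h
  rw [ENNReal.ofReal_mul (by positivity),
    ENNReal.ofReal_sum_of_nonneg fun _ _ => by positivity] at h2
  simpa [ENNReal.ofReal_pow, ofReal_norm] using h2

variable {Ω : Type*} [mΩ : MeasurableSpace Ω] {𝓕 : Filtration ℝ≥0 mΩ} {P : Measure Ω}

/-- Measurability is asked only of the majorant G, so none has to be shown for the true integrand Φ.
-/
theorem lintegral_lintegral_enorm_sq_le {E : Type*} [NormedAddCommGroup E] {μ : Measure ℝ}
    [SFinite P] {X Φ : ℝ → Ω → E} {G : ℝ → Ω → ℝ≥0∞} (hG : Measurable (Function.uncurry G))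
    (hΦ : ∀ᵐ r ∂μ, ∀ᵐ ω ∂P, ‖Φ r ω‖ₑ ^ 2 ≤ G r ω) :
    ∫⁻ r, ∫⁻ ω, ‖X r ω‖ₑ ^ 2 ∂P ∂μ ≤ 2 * ∫⁻ r, ∫⁻ ω, G r ω ∂P ∂μ +
      2 * ∫⁻ r, ∫⁻ ω, ‖X r ω - Φ r ω‖ₑ ^ 2 ∂P ∂μ := by
  have hGr : ∀ r, Measurable (G r) := fun r => hG.comp measurable_prodMk_left
  have hGI : Measurable fun r => ∫⁻ ω, G r ω ∂P := hG.lintegral_prod_right'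
  rw [← lintegral_const_mul' _ _ (by simp), ← lintegral_const_mul' _ _ (by simp),
    ← lintegral_add_left (hGI.const_mul _)]
  refine lintegral_mono_ae (hΦ.mono fun r hr => ?_)
  rw [← lintegral_const_mul' _ _ (by simp), ← lintegral_const_mul' _ _ (by simp),
    ← lintegral_add_left ((hGr r).const_mul _)]
  refine lintegral_mono_ae (hr.mono fun ω hω => ?_)
  have := enorm_sq_add_le (Φ r ω) (X r ω - Φ r ω)
  rw [add_sub_cancel] at this
  exact this.trans (by gcongr)

namespace IsOrthogonalNoise

variable {ι : Type*} [DecidableEq ι] {W : ι → ℝ≥0 → Ω → ℂ}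
  {E : Type*} [NormedAddCommGroup E] [InnerProductSpace ℂ E]

theorem stronglyMeasurable_integral (hW : IsOrthogonalNoise 𝓕 P W) (p : ι)
    (X : SimpleProcess 𝓕 E) : StronglyMeasurable (X.integral (W p)) := by
  unfold SimpleProcess.integral
  refine Finset.stronglyMeasurable_fun_sum _ fun i _ => ?_
  have h : ∀ r, StronglyMeasurable (W p r) := fun r => (hW.adapted p r).mono (𝓕.le r)
  exact ((h _).sub (h _)).smul ((X.ξ_meas i).mono (𝓕.le _))

/-- The factor 8 is 2·2·2: one from E|ΔW|² = 2Δt, one from replacing Y by simple integrals, one from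
replacing simple integrands by Φ. For a finite set of modes both errors vanish in the limit. -/
theorem lintegral_enorm_sq_sum_ito_le (hW : IsOrthogonalNoise 𝓕 P W) [IsProbabilityMeasure P]
    (S : Finset ι) (c : ι → ℂ) {s t : ℝ≥0} {Φ : ι → ℝ≥0 → Ω → E} {Y : ι → Ω → E}
    (hY : ∀ p, IsItoIntegral 𝓕 P (W p) s t (Φ p) (Y p)) {G : ι → ℝ → Ω → ℝ≥0∞}
    (hG : ∀ p, Measurable (Function.uncurry (G p)))
    (hΦ : ∀ p, ∀ᵐ r ∂(volume.restrict (Set.Ioc (s : ℝ) t)), ∀ᵐ ω ∂P,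
      ‖Φ p r.toNNReal ω‖ₑ ^ 2 ≤ G p r ω) :
    ∫⁻ ω, ‖∑ p ∈ S, c p • Y p ω‖ₑ ^ 2 ∂P ≤
      ∑ p ∈ S, 8 * ‖c p‖ₑ ^ 2 * ∫⁻ r in Set.Ioc (s : ℝ) t, ∫⁻ ω, G p r ω ∂P := by
  choose hYm X hXτ hXΦ hXY using hY
  have hI : ∀ p m, AEStronglyMeasurable ((X p m).integral (W p)) P := fun p m =>
    (hW.stronglyMeasurable_integral p _).aestronglyMeasurable
  have hdiff : ∀ m, ∫⁻ ω, ‖∑ p ∈ S, c p • (Y p ω - (X p m).integral (W p) ω)‖ₑ ^ 2 ∂P ≤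
      S.card * ∑ p ∈ S, ‖c p‖ₑ ^ 2 * ∫⁻ ω, ‖(X p m).integral (W p) ω - Y p ω‖ₑ ^ 2 ∂P := by
    intro m
    refine (lintegral_mono fun ω => enorm_sq_sum_le _ _).trans ?_
    have hm : ∀ p ∈ S, AEMeasurable
        (fun ω => ‖c p • (Y p ω - (X p m).integral (W p) ω)‖ₑ ^ 2) P := fun p _ =>
      (((hYm p).sub (hI p m)).const_smul (c p)).enorm.pow_const 2
    rw [lintegral_const_mul' _ _ (by simp), lintegral_finsetSum' _ hm]
    gcongr with p _
    rw [← lintegral_const_mul' _ _ (by simp)]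
    refine lintegral_mono fun ω => ?_
    rw [enorm_smul, mul_pow, enorm_sub_rev]
  have hmain : ∀ m, ∫⁻ ω, ‖∑ p ∈ S, c p • Y p ω‖ₑ ^ 2 ∂P ≤
      (∑ p ∈ S, 8 * ‖c p‖ₑ ^ 2 * ∫⁻ r in Set.Ioc (s : ℝ) t, ∫⁻ ω, G p r ω ∂P) +
      ((∑ p ∈ S, 8 * ‖c p‖ₑ ^ 2 * ∫⁻ r in Set.Ioc (s : ℝ) t,
        ∫⁻ ω, ‖(X p m).val r.toNNReal ω - Φ p r.toNNReal ω‖ₑ ^ 2 ∂P) +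
      2 * (S.card * ∑ p ∈ S, ‖c p‖ₑ ^ 2 *
        ∫⁻ ω, ‖(X p m).integral (W p) ω - Y p ω‖ₑ ^ 2 ∂P)) := by
    intro m
    have h1 : ∫⁻ ω, ‖∑ p ∈ S, c p • Y p ω‖ₑ ^ 2 ∂P ≤
        2 * ∫⁻ ω, ‖∑ p ∈ S, c p • (X p m).integral (W p) ω‖ₑ ^ 2 ∂P +
        2 * ∫⁻ ω, ‖∑ p ∈ S, c p • (Y p ω - (X p m).integral (W p) ω)‖ₑ ^ 2 ∂P := by
      have hm : AEMeasurable
          (fun ω => 2 * ‖∑ p ∈ S, c p • (X p m).integral (W p) ω‖ₑ ^ 2) P :=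
        ((Finset.aestronglyMeasurable_fun_sum S fun p _ =>
          (hI p m).const_smul (c p)).enorm.pow_const 2).const_mul _
      rw [← lintegral_const_mul' _ _ (by simp), ← lintegral_const_mul' _ _ (by simp),
        ← lintegral_add_left' hm]
      refine lintegral_mono fun ω => ?_
      refine le_trans (le_of_eq ?_) (enorm_sq_add_le _ _)
      rw [← Finset.sum_add_distrib]
      simp only [smul_sub, add_sub_cancel]
    have h2 := hW.lintegral_enorm_sq_sum_integral_le S c (fun p => X p m)
      fun p _ i => hXτ p m i
    have h3 : ∑ p ∈ S, 2 * ‖c p‖ₑ ^ 2 *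
        ∫⁻ r in Set.Ioc (s : ℝ) t, ∫⁻ ω, ‖(X p m).val r.toNNReal ω‖ₑ ^ 2 ∂P ≤
        ∑ p ∈ S, 2 * ‖c p‖ₑ ^ 2 * (2 * (∫⁻ r in Set.Ioc (s : ℝ) t, ∫⁻ ω, G p r ω ∂P) +
        2 * ∫⁻ r in Set.Ioc (s : ℝ) t,
          ∫⁻ ω, ‖(X p m).val r.toNNReal ω - Φ p r.toNNReal ω‖ₑ ^ 2 ∂P) := by
      refine Finset.sum_le_sum fun p _ => ?_
      gcongr
      exact lintegral_lintegral_enorm_sq_le (hG p) (hΦ p)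
    refine (h1.trans (add_le_add (mul_le_mul_right (h2.trans h3) 2)
      (mul_le_mul_right (hdiff m) 2))).trans (le_of_eq ?_)
    rw [← add_assoc, ← Finset.sum_add_distrib, Finset.mul_sum]
    congr 1
    refine Finset.sum_congr rfl fun p _ => ?_
    ring
  have hlim : Tendsto (fun m =>
      (∑ p ∈ S, 8 * ‖c p‖ₑ ^ 2 * ∫⁻ r in Set.Ioc (s : ℝ) t, ∫⁻ ω, G p r ω ∂P) +
      ((∑ p ∈ S, 8 * ‖c p‖ₑ ^ 2 * ∫⁻ r in Set.Ioc (s : ℝ) t,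
        ∫⁻ ω, ‖(X p m).val r.toNNReal ω - Φ p r.toNNReal ω‖ₑ ^ 2 ∂P) +
      2 * (S.card * ∑ p ∈ S, ‖c p‖ₑ ^ 2 *
        ∫⁻ ω, ‖(X p m).integral (W p) ω - Y p ω‖ₑ ^ 2 ∂P))) atTop
      (𝓝 ((∑ p ∈ S, 8 * ‖c p‖ₑ ^ 2 * ∫⁻ r in Set.Ioc (s : ℝ) t, ∫⁻ ω, G p r ω ∂P) +
        ((∑ p ∈ S, 8 * ‖c p‖ₑ ^ 2 * 0) + 2 * (S.card * ∑ p ∈ S, ‖c p‖ₑ ^ 2 * 0)))) := by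
    refine tendsto_const_nhds.add (Tendsto.add ?_ ?_)
    · refine tendsto_finsetSum _ fun p _ => ?_
      exact ENNReal.Tendsto.const_mul (hXΦ p) (Or.inr (by finiteness))
    · refine ENNReal.Tendsto.const_mul (ENNReal.Tendsto.const_mul
        (tendsto_finsetSum _ fun p _ => ?_) (Or.inr (by simp))) (Or.inr (by simp))
      exact ENNReal.Tendsto.const_mul (hXY p) (Or.inr (by finiteness))
  have := ge_of_tendsto' hlim hmain
  simpa using this

end IsOrthogonalNoise

/-! ### The noise has orthogonal increments -/

theorem IsBrownianReal.memLp_increment {B : ℝ≥0 → Ω → ℝ} (hB : IsBrownianReal B P) (s t : ℝ≥0) :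
    MemLp (fun ω => B t ω - B s ω) 2 P := by
  have h := hB.toIsPreBrownianReal.hasLaw_sub t s
  have := memLp_id_gaussianReal' (μ := 0) (v := nndist (t : ℝ) s) 2 (by simp)
  have hmap : P.map (B t - B s) = gaussianReal 0 (nndist (t : ℝ) s) := h.map_eq
  rw [← hmap] at this
  exact (memLp_map_measure_iff (by fun_prop) h.aemeasurable).1 this

theorem IsBrownianReal.integral_increment {B : ℝ≥0 → Ω → ℝ} (hB : IsBrownianReal B P)
    (s t : ℝ≥0) : ∫ ω, (B t ω - B s ω) ∂P = 0 := by
  have h := (hB.toIsPreBrownianReal.hasLaw_sub t s).integral_eq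
  rw [integral_id_gaussianReal] at h
  exact h

theorem IsBrownianReal.integral_increment_sq [IsProbabilityMeasure P] {B : ℝ≥0 → Ω → ℝ}
    (hB : IsBrownianReal B P) {s t : ℝ≥0} (hst : s ≤ t) :
    ∫ ω, (B t ω - B s ω) * (B t ω - B s ω) ∂P = t - s := by
  have h := (hB.toIsPreBrownianReal.hasLaw_sub t s).variance_eq
  rw [variance_id_gaussianReal, variance_of_integral_eq_zero
    (hB.toIsPreBrownianReal.hasLaw_sub t s).aemeasurable
    (IsBrownianReal.integral_increment hB s t)] at h
  have hd : ((nndist (t : ℝ) s : ℝ≥0) : ℝ) = t - s := by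
    rw [coe_nndist, Real.dist_eq, abs_of_nonneg (sub_nonneg.2 (by exact_mod_cast hst))]
  refine Eq.trans ?_ (h.trans hd)
  simp only [Pi.sub_apply, sq]

theorem integral_mul_ofReal_add_I {x₁ y₁ x₂ y₂ : Ω → ℝ} (hx₁ : MemLp x₁ 2 P) (hy₁ : MemLp y₁ 2 P)
    (hx₂ : MemLp x₂ 2 P) (hy₂ : MemLp y₂ 2 P) :
    ∫ ω, ((x₁ ω : ℂ) + y₁ ω * Complex.I) * ((x₂ ω : ℂ) + y₂ ω * Complex.I) ∂P =
      ((∫ ω, x₁ ω * x₂ ω ∂P : ℝ) - (∫ ω, y₁ ω * y₂ ω ∂P : ℝ) : ℂ) +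
      ((∫ ω, x₁ ω * y₂ ω ∂P : ℝ) + (∫ ω, y₁ ω * x₂ ω ∂P : ℝ) : ℂ) * Complex.I := by
  have h : ∀ ω, ((x₁ ω : ℂ) + y₁ ω * Complex.I) * ((x₂ ω : ℂ) + y₂ ω * Complex.I) =
      (((x₁ ω * x₂ ω : ℝ) : ℂ) - ((y₁ ω * y₂ ω : ℝ) : ℂ)) +
      (((x₁ ω * y₂ ω : ℝ) : ℂ) + ((y₁ ω * x₂ ω : ℝ) : ℂ)) * Complex.I := fun ω => by
    push_cast
    linear_combination (y₁ ω : ℂ) * y₂ ω * Complex.I_mul_I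
  have i1 : Integrable (fun ω => ((x₁ ω * x₂ ω : ℝ) : ℂ)) P := (hx₁.integrable_mul hx₂).ofReal
  have i2 : Integrable (fun ω => ((y₁ ω * y₂ ω : ℝ) : ℂ)) P := (hy₁.integrable_mul hy₂).ofReal
  have i3 : Integrable (fun ω => ((x₁ ω * y₂ ω : ℝ) : ℂ)) P := (hx₁.integrable_mul hy₂).ofReal
  have i4 : Integrable (fun ω => ((y₁ ω * x₂ ω : ℝ) : ℂ)) P := (hy₁.integrable_mul hx₂).ofReal
  simp only [h]
  rw [integral_add (f := fun ω => ((x₁ ω * x₂ ω : ℝ) : ℂ) - ((y₁ ω * y₂ ω : ℝ) : ℂ))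
    (g := fun ω => (((x₁ ω * y₂ ω : ℝ) : ℂ) + ((y₁ ω * x₂ ω : ℝ) : ℂ)) * Complex.I)
    (i1.sub i2) ((i3.add i4).mul_const _), integral_sub i1 i2, integral_mul_const,
    integral_add i3 i4]
  simp only [integral_complex_ofReal]

namespace IsNoise

variable {d : ℕ} {W : NonzeroFreq d → Fin (d - 1) → ℝ≥0 → Ω → ℂ}

theorem increment_eq {Ω' : Type*} (w : ℝ≥0 → Ω' → ℂ) (s t : ℝ≥0) (ω : Ω') :
    w t ω - w s ω = ((reIm w true t ω - reIm w true s ω : ℝ) : ℂ) +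
      ((reIm w false t ω - reIm w false s ω : ℝ) : ℂ) * Complex.I := by
  apply Complex.ext <;> simp [reIm]

theorem memLp_increment (hW : IsNoise 𝓕 P W) (k : NonzeroFreq d) (i : Fin (d - 1)) (s t : ℝ≥0) :
    MemLp (fun ω => W k i t ω - W k i s ω) 2 P := by
  rw [← memLp_re_im_iff]
  refine ⟨?_, ?_⟩
  · simpa [reIm] using IsBrownianReal.memLp_increment (hW.brownian k i true) s t
  · simpa [reIm] using IsBrownianReal.memLp_increment (hW.brownian k i false) s t

theorem integral_increment [IsProbabilityMeasure P] (hW : IsNoise 𝓕 P W) (k : NonzeroFreq d)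
    (i : Fin (d - 1)) (s t : ℝ≥0) :
    ∫ ω, (W k i t ω - W k i s ω) ∂P = 0 := by
  have h : ∀ b, Integrable
      (fun ω => ((reIm (W k i) b t ω - reIm (W k i) b s ω : ℝ) : ℂ)) P := fun b =>
    ((IsBrownianReal.memLp_increment (hW.brownian k i b) s t).integrable (by norm_num)).ofReal
  have h0 := fun b => IsBrownianReal.integral_increment (hW.brownian k i b) s t
  simp only [increment_eq]
  rw [integral_add (h true) ((h false).mul_const _), integral_mul_const]
  simp only [integral_complex_ofReal, h0]
  simp

theorem integral_reIm_mul [IsProbabilityMeasure P] (hW : IsNoise 𝓕 P W) {S : Set (NonzeroFreq d)}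
    (hS : iIndepFun (fun (p : S × Fin (d - 1) × Bool) (ω : Ω) (t : ℝ≥0) =>
      reIm (W p.1.1 p.2.1) p.2.2 t ω) P) {s t : ℝ≥0} (hst : s ≤ t)
    (p q : S × Fin (d - 1) × Bool) :
    ∫ ω, (reIm (W p.1.1 p.2.1) p.2.2 t ω - reIm (W p.1.1 p.2.1) p.2.2 s ω) *
      (reIm (W q.1.1 q.2.1) q.2.2 t ω - reIm (W q.1.1 q.2.1) q.2.2 s ω) ∂P =
      if p = q then (t : ℝ) - s else 0 := by
  split_ifs with h
  · subst h
    exact IsBrownianReal.integral_increment_sq (hW.brownian _ _ _) hst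
  · have hm : Measurable fun x : ℝ≥0 → ℝ => x t - x s :=
      (measurable_pi_apply t).sub (measurable_pi_apply s)
    have hi := (hS.indepFun h).comp hm hm
    have := hi.integral_fun_mul_eq_mul_integral
      (IsBrownianReal.memLp_increment (hW.brownian p.1.1 p.2.1 p.2.2) s t).1
      (IsBrownianReal.memLp_increment (hW.brownian q.1.1 q.2.1 q.2.2) s t).1
    refine this.trans ?_
    simp only [Function.comp_apply]
    rw [IsBrownianReal.integral_increment (hW.brownian p.1.1 p.2.1 p.2.2), zero_mul]

/-- Without a conjugate, the equal variances of the real and imaginary parts cancel and the cross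
terms vanish. This is what makes W^k and W^(-k) = conj W^k uncorrelated although they determine each
other. -/
theorem integral_mul_of_mem [IsProbabilityMeasure P] (hW : IsNoise 𝓕 P W)
    {S : Set (NonzeroFreq d)}
    (hS : iIndepFun (fun (p : S × Fin (d - 1) × Bool) (ω : Ω) (t : ℝ≥0) =>
      reIm (W p.1.1 p.2.1) p.2.2 t ω) P) {s t : ℝ≥0} (hst : s ≤ t) {k l : NonzeroFreq d}
    (hk : k ∈ S) (hl : l ∈ S) (i j : Fin (d - 1)) :
    ∫ ω, (W k i t ω - W k i s ω) * (W l j t ω - W l j s ω) ∂P = 0 := by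
  have h := fun b b' => hW.integral_reIm_mul hS hst (⟨k, hk⟩, i, b) (⟨l, hl⟩, j, b')
  have hm := fun k i b => IsBrownianReal.memLp_increment (hW.brownian k i b) s t
  simp only [increment_eq]
  rw [integral_mul_ofReal_add_I (hm _ _ _) (hm _ _ _) (hm _ _ _) (hm _ _ _)]
  simp only at h
  rw [h, h, h, h]
  simp

theorem integral_conj_mul_of_mem [IsProbabilityMeasure P] (hW : IsNoise 𝓕 P W)
    {S : Set (NonzeroFreq d)}
    (hS : iIndepFun (fun (p : S × Fin (d - 1) × Bool) (ω : Ω) (t : ℝ≥0) =>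
      reIm (W p.1.1 p.2.1) p.2.2 t ω) P) {s t : ℝ≥0} (hst : s ≤ t) {k l : NonzeroFreq d}
    (hk : k ∈ S) (hl : l ∈ S) (i j : Fin (d - 1)) :
    ∫ ω, conj (W k i t ω - W k i s ω) * (W l j t ω - W l j s ω) ∂P =
      if (k, i) = (l, j) then ((2 * ((t : ℝ) - s) : ℝ) : ℂ) else 0 := by
  have h := fun b b' => hW.integral_reIm_mul hS hst (⟨k, hk⟩, i, b) (⟨l, hl⟩, j, b')
  have hm := fun k i b => IsBrownianReal.memLp_increment (hW.brownian k i b) s t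
  have hc : ∀ ω, conj (W k i t ω - W k i s ω) =
      ((reIm (W k i) true t ω - reIm (W k i) true s ω : ℝ) : ℂ) +
      ((-(reIm (W k i) false t ω - reIm (W k i) false s ω) : ℝ) : ℂ) * Complex.I := fun ω => by
    apply Complex.ext
    · simp [reIm]
    · simp [reIm]
      ring
  have hm' : MemLp (fun ω => -(reIm (W k i) false t ω - reIm (W k i) false s ω)) 2 P :=
    (hm k i false).neg
  simp only [hc]
  simp only [increment_eq]
  rw [integral_mul_ofReal_add_I (hm _ _ _) hm' (hm _ _ _) (hm _ _ _)]
  simp only [neg_mul, integral_neg] at h ⊢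
  rw [h, h, h, h]
  by_cases hkl : (k, i) = (l, j)
  · obtain ⟨rfl, rfl⟩ := Prod.mk.inj hkl
    simp
    ring
  · have : ¬ (k = l ∧ i = j) := fun h => hkl (by rw [h.1, h.2])
    simp [this]

theorem negFreq_injective : Function.Injective (negFreq (d := d)) := fun k l h => by
  simpa [negFreq, Subtype.ext_iff] using h

theorem isOrthogonalNoise [IsProbabilityMeasure P] (hW : IsNoise 𝓕 P W) :
    IsOrthogonalNoise 𝓕 P fun (p : NonzeroFreq d × Fin (d - 1)) => W p.1 p.2 where
  adapted p := hW.adapted p.1 p.2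
  memLp p := hW.memLp_increment p.1 p.2
  mean p := hW.integral_increment p.1 p.2
  indep := hW.indep_past
  cov := by
    rintro ⟨k, i⟩ ⟨l, j⟩ s t hst
    obtain ⟨S, hneg, hS⟩ := hW.indep_modes
    have hconj : ∀ k i, ∀ᵐ ω ∂P, W k i t ω - W k i s ω =
        conj (W (negFreq k) i t ω - W (negFreq k) i s ω) := fun k i => by
      filter_upwards [hW.conj_symm k i] with ω hω
      rw [hω, hω, map_sub, Complex.conj_conj, Complex.conj_conj]
    have hmem : ∀ k, k ∉ S → negFreq k ∈ S := fun k hk => by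
      by_contra h
      exact hk ((hneg k).2 h)
    simp only
    -- A mode outside S is the conjugate of one inside. One such replacement produces a product
    -- without conjugate, which integrates to zero; two replacements swap the roles of the modes.
    by_cases hk : k ∈ S <;> by_cases hl : l ∈ S
    · exact hW.integral_conj_mul_of_mem hS hst hk hl i j
    · have h0 := congrArg conj (hW.integral_mul_of_mem hS hst hk (hmem l hl) i j)
      rw [← integral_conj, map_zero] at h0
      rw [if_neg (by rintro ⟨⟩; exact hl hk), ← h0]
      refine integral_congr_ae ?_
      filter_upwards [hconj l j] with ω hω
      rw [hω, map_mul]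
    · have h0 := hW.integral_mul_of_mem hS hst (hmem k hk) hl i j
      rw [if_neg (by rintro ⟨⟩; exact hk hl), ← h0]
      refine integral_congr_ae ?_
      filter_upwards [hconj k i] with ω hω
      rw [hω, Complex.conj_conj]
    · have h0 := hW.integral_conj_mul_of_mem hS hst (hmem l hl) (hmem k hk) j i
      have he : ((negFreq l, j) = (negFreq k, i)) = ((k, i) = (l, j)) := by
        simp only [Prod.mk.injEq, negFreq_injective.eq_iff, eq_comm]
      simp only [he] at h0
      rw [← h0]
      refine integral_congr_ae ?_
      filter_upwards [hconj k i, hconj l j] with ω h1 h2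
      rw [h1, h2, Complex.conj_conj, mul_comm]

end IsNoise

end TransportNoise

namespace TransportNoise

/-! ### Deterministic estimates -/

variable {d : ℕ}

/-- The energy put by the noise into the `l`-th Fourier mode. -/
noncomputable def modeEnergy (θ : NonzeroFreq d → ℝ)
    (a : NonzeroFreq d → Fin (d - 1) → EuclideanSpace ℝ (Fin d)) (u : VectorField d)
    (l : Fin d → ℤ) : ℝ≥0∞ :=
  ∑' p : NonzeroFreq d × Fin (d - 1), ENNReal.ofReal (θ p.1 ^ 2) *
    (ENNReal.ofReal (4 * Real.pi ^ 2 * (∑ j, a p.1 p.2 j * (l j : ℝ)) ^ 2) *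
      coefSq u (l - p.1.1))

theorem tsum_mul_convBound (θ : NonzeroFreq d → ℝ)
    (a : NonzeroFreq d → Fin (d - 1) → EuclideanSpace ℝ (Fin d)) (u : VectorField d) (τ : ℝ) :
    ∑' p : NonzeroFreq d × Fin (d - 1), ENNReal.ofReal (θ p.1 ^ 2) *
      convBound p.1.1 (a p.1 p.2) τ u =
    ∑' l, ENNReal.ofReal (Real.exp (-(2 * (4 * Real.pi ^ 2 * freqSq l) * τ))) *
      modeEnergy θ a u l := by
  simp only [convBound, modeEnergy, ← ENNReal.tsum_mul_left]
  rw [ENNReal.tsum_comm]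
  refine tsum_congr fun l => tsum_congr fun p => ?_
  ring

/-- Bessel's inequality for the orthonormal directions. -/
theorem sum_sq_le_freqSq {v : Fin (d - 1) → EuclideanSpace ℝ (Fin d)} (hv : Orthonormal ℝ v)
    (l : Fin d → ℤ) : ∑ i, (∑ j, v i j * (l j : ℝ)) ^ 2 ≤ freqSq l := by
  have h := hv.sum_inner_products_le (s := Finset.univ) (WithLp.toLp 2 fun j => (l j : ℝ))
  rw [EuclideanSpace.norm_sq_eq] at h
  simpa [PiLp.inner_apply, freqSq, mul_comm] using h

theorem sum_ofReal_sq_le_freqSq {v : Fin (d - 1) → EuclideanSpace ℝ (Fin d)}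
    (hv : Orthonormal ℝ v) (l : Fin d → ℤ) :
    ∑ i, ENNReal.ofReal (4 * Real.pi ^ 2 * (∑ j, v i j * (l j : ℝ)) ^ 2) ≤
      ENNReal.ofReal (4 * Real.pi ^ 2 * freqSq l) := by
  rw [← ENNReal.ofReal_sum_of_nonneg fun _ _ => by positivity, ← Finset.mul_sum]
  gcongr
  exact sum_sq_le_freqSq hv l

theorem modeEnergy_eq (θ : NonzeroFreq d → ℝ)
    (a : NonzeroFreq d → Fin (d - 1) → EuclideanSpace ℝ (Fin d)) (u : VectorField d)
    (l : Fin d → ℤ) :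
    modeEnergy θ a u l = ∑' k : NonzeroFreq d, ENNReal.ofReal (θ k ^ 2) *
      ((∑ i, ENNReal.ofReal (4 * Real.pi ^ 2 * (∑ j, a k i j * (l j : ℝ)) ^ 2)) *
        coefSq u (l - k.1)) := by
  rw [modeEnergy, ENNReal.tsum_prod']
  refine tsum_congr fun k => ?_
  rw [tsum_fintype, Finset.sum_mul, Finset.mul_sum]

/-- The coefficients θ_k² are replaced by T² and the symbols by Bessel at frequency l; the shift k ↦
l-k is injective, so the remaining sum is at most ‖u‖². -/
theorem modeEnergy_le {θ : NonzeroFreq d → ℝ}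
    {a : NonzeroFreq d → Fin (d - 1) → EuclideanSpace ℝ (Fin d)} (ha : IsNoiseFrame a)
    {T : ℝ} (hT : ∀ k, |θ k| ≤ T) (u : VectorField d) (l : Fin d → ℤ) :
    modeEnergy θ a u l ≤
      ENNReal.ofReal (T ^ 2) * (ENNReal.ofReal (4 * Real.pi ^ 2 * freqSq l) * ‖u‖ₑ ^ 2) := by
  rw [modeEnergy_eq, enorm_sq_eq_tsum_coefSq]
  have hinj : Function.Injective fun k : NonzeroFreq d => l - k.1 :=
    fun k k' h => Subtype.ext (by simpa using h)
  refine le_trans ?_ (mul_le_mul_right (mul_le_mul_right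
    (ENNReal.tsum_comp_le_tsum_of_injective hinj (coefSq u)) _) _)
  rw [← ENNReal.tsum_mul_left, ← ENNReal.tsum_mul_left]
  refine ENNReal.tsum_le_tsum fun k => ?_
  exact mul_le_mul' (ENNReal.ofReal_le_ofReal (sq_le_sq.2 ((hT k).trans (le_abs_self T))))
    (mul_le_mul' (sum_ofReal_sq_le_freqSq (ha.orthonormal k) l) le_rfl)

/-- With the symbol read at l-k, summing over l first gives the full gradient norm for each k, and
the weights θ_k² add up to one. -/
theorem tsum_modeEnergy_le {θ : NonzeroFreq d → ℝ} (hθ : IsNoiseCoeff θ)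
    {a : NonzeroFreq d → Fin (d - 1) → EuclideanSpace ℝ (Fin d)} (ha : IsNoiseFrame a)
    (u : VectorField d) : ∑' l, modeEnergy θ a u l ≤ gradNormSq u := by
  have h1 : ∑' k, ENNReal.ofReal (θ k ^ 2) = 1 := by
    rw [← ENNReal.ofReal_tsum_of_nonneg (fun _ => by positivity) hθ.norm_one.summable,
      hθ.norm_one.tsum_eq, ENNReal.ofReal_one]
  have h2 : ∀ k : NonzeroFreq d, ∑' l : Fin d → ℤ,
      ENNReal.ofReal (4 * Real.pi ^ 2 * freqSq (l - k.1)) * coefSq u (l - k.1) = gradNormSq u := by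
    intro k
    rw [gradNormSq_eq_tsum_coefSq]
    exact (Equiv.subRight k.1).tsum_eq
      fun l => ENNReal.ofReal (4 * Real.pi ^ 2 * freqSq l) * coefSq u l
  have h3 : ∀ (k : NonzeroFreq d) i (l : Fin d → ℤ),
      ∑ j, a k i j * (l j : ℝ) = ∑ j, a k i j * ((l - k.1) j : ℝ) := fun k i l => by
    simp [mul_sub, Finset.sum_sub_distrib, ha.perp]
  simp only [modeEnergy_eq]
  rw [ENNReal.tsum_comm]
  calc _ ≤ ∑' k : NonzeroFreq d, ENNReal.ofReal (θ k ^ 2) * gradNormSq u := by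
        refine ENNReal.tsum_le_tsum fun k => ?_
        rw [ENNReal.tsum_mul_left, ← h2 k]
        gcongr with l
        rw [Finset.sum_congr rfl fun i _ => by rw [h3 k i l]]
        exact sum_ofReal_sq_le_freqSq (ha.orthonormal k) (l - k.1)
    _ = gradNormSq u := by rw [ENNReal.tsum_mul_right, h1, one_mul]

/-- The integral is at most min(1, 1/(xδ)), and this minimum is below every power (xδ)^(-η) with 0 ≤
η ≤ 1. -/
theorem lintegral_exp_neg_le {x δ η : ℝ} (hx : 0 < x) (hδ : 0 < δ) (hη₀ : 0 ≤ η) (hη₁ : η ≤ 1)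
    (n r : ℝ) :
    ∫⁻ t in Set.Icc n (n + 1),
      (Set.Ici r).indicator (fun t => ENNReal.ofReal (Real.exp (-(2 * x * (δ * (t - r)))))) t ≤
      ENNReal.ofReal ((x * δ) ^ (-η)) := by
  have hxδ : 0 < x * δ := mul_pos hx hδ
  rw [setLIntegral_indicator measurableSet_Ici]
  by_cases h1 : x * δ ≤ 1
  · calc _ ≤ ∫⁻ t in Set.Ici r ∩ Set.Icc n (n + 1), 1 := by
          refine setLIntegral_mono measurable_const fun t ht => ?_
          rw [← ENNReal.ofReal_one]
          refine ENNReal.ofReal_le_ofReal (Real.exp_le_one_iff.2 ?_)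
          have : 0 ≤ t - r := sub_nonneg.2 ht.1
          have : 0 ≤ 2 * x * (δ * (t - r)) := by positivity
          linarith
      _ ≤ volume (Set.Icc n (n + 1)) := by
          rw [setLIntegral_one]
          exact measure_mono Set.inter_subset_right
      _ = ENNReal.ofReal 1 := by rw [Real.volume_Icc]; simp
      _ ≤ _ := by
          refine ENNReal.ofReal_le_ofReal ?_
          exact Real.one_le_rpow_of_pos_of_le_one_of_nonpos hxδ h1 (by linarith)
  · have hneg : -(2 * x * δ) < 0 := by nlinarith
    calc _ ≤ ∫⁻ t in Set.Ici r, ENNReal.ofReal (Real.exp (-(2 * x * (δ * (t - r))))) :=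
          lintegral_mono_set Set.inter_subset_left
      _ = ∫⁻ t in Set.Ioi r, ENNReal.ofReal
            (Real.exp (2 * x * δ * r) * Real.exp (-(2 * x * δ) * t)) := by
          rw [setLIntegral_congr Ioi_ae_eq_Ici.symm]
          refine lintegral_congr fun t => ?_
          rw [← Real.exp_add]
          congr 2
          ring
      _ = ENNReal.ofReal (∫ t in Set.Ioi r,
            Real.exp (2 * x * δ * r) * Real.exp (-(2 * x * δ) * t)) := by
          rw [ofReal_integral_eq_lintegral_ofReal]
          · exact (integrableOn_exp_mul_Ioi hneg r).const_mul _
          · exact ae_of_all _ fun t => by positivity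
      _ = ENNReal.ofReal (1 / (2 * x * δ)) := by
          rw [integral_const_mul, integral_exp_mul_Ioi hneg]
          congr 1
          have : Real.exp (2 * x * δ * r) * Real.exp (-(2 * x * δ) * r) = 1 := by
            rw [← Real.exp_add]; simp
          rw [neg_div_neg_eq, ← mul_div_assoc, this]
      _ ≤ _ := by
          refine ENNReal.ofReal_le_ofReal ?_
          calc 1 / (2 * x * δ) ≤ (x * δ)⁻¹ := by
                rw [one_div]
                exact inv_anti₀ hxδ (by nlinarith)
            _ = (x * δ) ^ (-1 : ℝ) := (Real.rpow_neg_one _).symm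
            _ ≤ _ := Real.rpow_le_rpow_of_exponent_le (not_le.1 h1).le (by linarith)

/-- The lattice sum `∑_{l ≠ 0} (4π²|l|²)^(-b)`. -/
noncomputable def latticeSum (d : ℕ) (b : ℝ) : ℝ≥0∞ :=
  ∑' l : Fin d → ℤ, ENNReal.ofReal ((4 * Real.pi ^ 2 * freqSq l) ^ (-b))

theorem latticeSum_ne_top {b : ℝ} (hb : (d : ℝ) / 2 < b) : latticeSum d b ≠ ∞ := by
  let B := Pi.basisFun ℝ (Fin d)
  let L : Submodule ℤ (Fin d → ℝ) := Submodule.span ℤ (Set.range B)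
  have hfr : Module.finrank ℤ L = d := by
    rw [ZLattice.rank ℝ L]; simp
  have hsum := ZLattice.summable_norm_rpow L (-(2 * b)) (by rw [hfr]; linarith)
  have hmem : ∀ l : Fin d → ℤ, (fun j => (l j : ℝ)) ∈ L := fun l => by
    rw [Module.Basis.mem_span_iff_repr_mem]
    intro i
    exact ⟨l i, by simp [B]⟩
  let φ : (Fin d → ℤ) → L := fun l => ⟨fun j => (l j : ℝ), hmem l⟩
  have hφ : Function.Injective φ := fun l l' h => by
    funext j
    have := congrFun (congrArg Subtype.val h) j
    exact Int.cast_injective (α := ℝ) this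
  have hs := (hsum.comp_injective hφ)
  refine ne_top_of_le_ne_top hs.tsum_ofReal_ne_top (ENNReal.tsum_le_tsum fun l => ?_)
  refine ENNReal.ofReal_le_ofReal ?_
  have hb0 : 0 < b := lt_of_le_of_lt (by positivity) hb
  have hd0 := freqSq_nonneg l
  by_cases hl : l = 0
  · have : freqSq l = 0 := by simp [hl, freqSq]
    -- The zero frequency adds nothing, since a nonzero real power of 0 is 0.
    rw [this, mul_zero, Real.zero_rpow (by linarith)]
    exact Real.rpow_nonneg (norm_nonneg _) _
  have hpos := freqSq_pos hl
  have hnorm : ‖φ l‖ ^ 2 ≤ 4 * Real.pi ^ 2 * freqSq l := by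
    have h1 : ‖φ l‖ ≤ √(freqSq l) := by
      change ‖(fun j => (l j : ℝ))‖ ≤ _
      refine (pi_norm_le_iff_of_nonneg (Real.sqrt_nonneg _)).2 fun j => ?_
      refine Real.abs_le_sqrt ?_
      exact Finset.single_le_sum (f := fun j => (l j : ℝ) ^ 2) (fun _ _ => by positivity)
        (Finset.mem_univ j)
    have h2 : ‖φ l‖ ^ 2 ≤ freqSq l := by
      rw [← Real.sq_sqrt hd0]
      exact pow_le_pow_left₀ (norm_nonneg _) h1 2
    have : 1 ≤ 4 * Real.pi ^ 2 := by nlinarith [Real.pi_gt_three]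
    nlinarith
  have hφ0 : 0 < ‖φ l‖ := by
    rw [norm_pos_iff]
    intro h0
    exact hl (hφ (h0.trans (by ext; simp [φ])))
  have : ‖φ l‖ ^ (-(2 * b)) = (‖φ l‖ ^ 2) ^ (-b) := by
    rw [← Real.rpow_natCast, ← Real.rpow_mul hφ0.le]
    congr 1; push_cast; ring
  rw [Function.comp_apply, this]
  exact Real.rpow_le_rpow_of_nonpos (by positivity) hnorm (by linarith)

/-- The exponent μ(b+1) is chosen so that, after mₗ^μ has cost x^μ, the weight x^(-μb) remains,
which is the μ-th power of a term of the lattice sum. -/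
theorem tsum_modeEnergy_mul_le {θ : NonzeroFreq d → ℝ} (hθ : IsNoiseCoeff θ)
    {a : NonzeroFreq d → Fin (d - 1) → EuclideanSpace ℝ (Fin d)} (ha : IsNoiseFrame a)
    {T : ℝ} (hT : ∀ k, |θ k| ≤ T) {lam μ b δ : ℝ} (hlam : 0 < lam) (hμ : 0 < μ)
    (hlm : lam + μ = 1) (hδ : 0 < δ) (u : VectorField d) :
    ∑' l, ENNReal.ofReal ((4 * Real.pi ^ 2 * freqSq l * δ) ^ (-(μ * (b + 1)))) *
        modeEnergy θ a u l ≤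
      latticeSum d b ^ μ * ENNReal.ofReal (T ^ 2) ^ μ * ENNReal.ofReal (δ ^ (-(μ * (b + 1)))) *
        (gradNormSq u ^ lam * (‖u‖ₑ ^ 2) ^ μ) := by
  have hterm : ∀ l, ENNReal.ofReal ((4 * Real.pi ^ 2 * freqSq l * δ) ^ (-(μ * (b + 1)))) *
        modeEnergy θ a u l ≤
      ENNReal.ofReal (T ^ 2) ^ μ * ENNReal.ofReal (δ ^ (-(μ * (b + 1)))) * (‖u‖ₑ ^ 2) ^ μ *
        (modeEnergy θ a u l ^ lam *
          ENNReal.ofReal ((4 * Real.pi ^ 2 * freqSq l) ^ (-b)) ^ μ) := by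
    intro l
    have hle := modeEnergy_le ha hT u l
    by_cases hl : l = 0
    · have h0 : freqSq l = 0 := by simp [hl, freqSq]
      have : modeEnergy θ a u l = 0 := by simpa [h0] using hle
      simp [this]
    set x := 4 * Real.pi ^ 2 * freqSq l with hx
    have hx0 : 0 < x := by have := freqSq_pos hl; positivity
    set m := modeEnergy θ a u l
    have hm : m = m ^ lam * m ^ μ := by
      rw [← ENNReal.rpow_add_of_nonneg _ _ hlam.le hμ.le, hlm, ENNReal.rpow_one]
    calc ENNReal.ofReal ((x * δ) ^ (-(μ * (b + 1)))) * m
        = ENNReal.ofReal ((x * δ) ^ (-(μ * (b + 1)))) * (m ^ lam * m ^ μ) := by rw [← hm]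
      _ ≤ ENNReal.ofReal ((x * δ) ^ (-(μ * (b + 1)))) * (m ^ lam *
          (ENNReal.ofReal (T ^ 2) * (ENNReal.ofReal x * ‖u‖ₑ ^ 2)) ^ μ) := by gcongr
      _ = _ := by
        rw [Real.mul_rpow hx0.le hδ.le, ENNReal.ofReal_mul (by positivity),
          ENNReal.mul_rpow_of_nonneg _ _ hμ.le, ENNReal.mul_rpow_of_nonneg _ _ hμ.le]
        have : ENNReal.ofReal (x ^ (-(μ * (b + 1)))) * ENNReal.ofReal x ^ μ =
            ENNReal.ofReal (x ^ (-b)) ^ μ := by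
          rw [ENNReal.ofReal_rpow_of_pos hx0, ENNReal.ofReal_rpow_of_nonneg (by positivity) hμ.le,
            ← ENNReal.ofReal_mul (by positivity), ← Real.rpow_add hx0, ← Real.rpow_mul hx0.le]
          congr 2; ring
        rw [← this]
        ring
  refine (ENNReal.tsum_le_tsum hterm).trans ?_
  rw [ENNReal.tsum_mul_left]
  -- Hölder over frequencies, with exponents 1/λ and 1/μ for counting measure.
  have hH := ENNReal.lintegral_mul_norm_pow_le (μ := Measure.count)
    (f := modeEnergy θ a u)
    (g := fun l : Fin d → ℤ => ENNReal.ofReal ((4 * Real.pi ^ 2 * freqSq l) ^ (-b)))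
    (measurable_of_countable _).aemeasurable (measurable_of_countable _).aemeasurable
    hlam.le hμ.le hlm
  simp only [lintegral_count] at hH
  calc _ ≤ ENNReal.ofReal (T ^ 2) ^ μ * ENNReal.ofReal (δ ^ (-(μ * (b + 1)))) * (‖u‖ₑ ^ 2) ^ μ *
        (gradNormSq u ^ lam * latticeSum d b ^ μ) := by
        gcongr
        refine hH.trans ?_
        gcongr
        · exact tsum_modeEnergy_le hθ ha u
        · exact le_rfl
    _ = _ := by ring

end TransportNoise

namespace TransportNoise

/-! ### The stochastic convolution -/

variable {d : ℕ} {Ω : Type*} [mΩ : MeasurableSpace Ω] {P : Measure Ω} {𝓕 : Filtration ℝ≥0 mΩ}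

/-- Progressive measurability gives joint measurability on bounded time intervals; freezing the
process at T extends it to all times. -/
theorem stronglyMeasurable_stopped_uncurry {E : Type*} [TopologicalSpace E] {f : ℝ≥0 → Ω → E}
    (hf : IsStronglyProgressive 𝓕 f) (T : ℝ≥0) :
    StronglyMeasurable fun q : ℝ × Ω => f (min q.1.toNNReal T) q.2 := by
  have h : StronglyMeasurable fun q : Set.Iic T × Ω => f q.1 q.2 :=
    (hf T).mono (sup_le_sup le_rfl (MeasurableSpace.comap_mono (𝓕.le T)))
  have hm : Measurable fun q : ℝ × Ω =>
      ((⟨min q.1.toNNReal T, Set.mem_Iic.2 (min_le_right _ _)⟩ : Set.Iic T), q.2) :=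
    Measurable.prodMk (Measurable.subtype_mk (by fun_prop)) measurable_snd
  exact h.comp_measurable hm

theorem measurable_convBound {A : Type*} [MeasurableSpace A] {g : A → VectorField d}
    (hg : StronglyMeasurable g) {τ : A → ℝ} (hτ : Measurable τ) (k : Fin d → ℤ)
    (a : EuclideanSpace ℝ (Fin d)) : Measurable fun x => convBound k a (τ x) (g x) := by
  unfold convBound
  refine Measurable.tsum fun l => Measurable.mul ?_ ((measurable_coefSq_comp hg _).const_mul _)
  fun_prop

theorem measurable_modeEnergy {A : Type*} [MeasurableSpace A] {g : A → VectorField d}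
    (hg : StronglyMeasurable g) (θ : NonzeroFreq d → ℝ)
    (a : NonzeroFreq d → Fin (d - 1) → EuclideanSpace ℝ (Fin d)) (l : Fin d → ℤ) :
    Measurable fun x => modeEnergy θ a (g x) l := by
  unfold modeEnergy
  exact Measurable.tsum fun p => ((measurable_coefSq_comp hg _).const_mul _).const_mul _

theorem tsum_mul_lintegral_lintegral {ι : Type*} [Countable ι] [SFinite P] {m : Measure ℝ}
    (w : ι → ℝ≥0∞) {G : ι → ℝ → Ω → ℝ≥0∞} (hG : ∀ p, Measurable (Function.uncurry (G p))) :
    ∑' p, w p * ∫⁻ r, ∫⁻ ω, G p r ω ∂P ∂m = ∫⁻ r, ∫⁻ ω, ∑' p, w p * G p r ω ∂P ∂m := by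
  have hGr : ∀ p r, Measurable (G p r) := fun p r => (hG p).comp measurable_prodMk_left
  have hGI : ∀ p, Measurable fun r => ∫⁻ ω, G p r ω ∂P := fun p =>
    (hG p).lintegral_prod_right'
  have h1 : ∀ r, ∫⁻ ω, ∑' p, w p * G p r ω ∂P = ∑' p, w p * ∫⁻ ω, G p r ω ∂P := fun r => by
    rw [lintegral_tsum fun p => ((hGr p r).const_mul _).aemeasurable]
    exact tsum_congr fun p => lintegral_const_mul _ (hGr p r)
  rw [lintegral_congr h1, lintegral_tsum fun p => ((hGI p).const_mul _).aemeasurable]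
  exact tsum_congr fun p => (lintegral_const_mul _ (hGI p)).symm

theorem lintegral_enorm_sq_stochConvolution_le [IsProbabilityMeasure P] {κ δ : ℝ} (hκ : 0 < κ)
    (hd : 2 ≤ d) {θ : NonzeroFreq d → ℝ}
    {a : NonzeroFreq d → Fin (d - 1) → EuclideanSpace ℝ (Fin d)} (ha : IsNoiseFrame a)
    {W : NonzeroFreq d → Fin (d - 1) → ℝ≥0 → Ω → ℂ} (hW : IsNoise 𝓕 P W)
    {f : ℝ≥0 → Ω → VectorField d} {g : ℝ → Ω → VectorField d}
    (hg : StronglyMeasurable (Function.uncurry g)) {s t : ℝ≥0}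
    (hgf : ∀ r ∈ Set.Ioc (s : ℝ) t, ∀ ω, g r ω = f r.toNNReal ω)
    (hfin : ∀ᵐ r ∂(volume.restrict (Set.Ioc (s : ℝ) t)), ∀ᵐ ω ∂P, gradNormSq (g r ω) ≠ ∞)
    {Z : Ω → VectorField d} (hZ : IsStochConvolution 𝓕 P κ δ θ a W f s t Z) :
    ∫⁻ ω, ‖Z ω‖ₑ ^ 2 ∂P ≤ ENNReal.ofReal (32 * κ) * ∫⁻ r in Set.Ioc (s : ℝ) t, ∫⁻ ω,
      ∑' l, ENNReal.ofReal (Real.exp (-(2 * (4 * Real.pi ^ 2 * freqSq l) * (δ * (t - r))))) *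
        modeEnergy θ a (g r ω) l ∂P := by
  obtain ⟨hZm, Y, hY, hlim⟩ := hZ
  set c : NonzeroFreq d × Fin (d - 1) → ℂ := fun p =>
    ((√((d : ℝ) / ((d : ℝ) - 1) * κ) * θ p.1 : ℝ) : ℂ) with hc
  let G : NonzeroFreq d × Fin (d - 1) → ℝ → Ω → ℝ≥0∞ := fun p r ω =>
    convBound p.1.1 (a p.1 p.2) (δ * (t - r)) (g r ω)
  have hG : ∀ p, Measurable (Function.uncurry (G p)) := fun p =>
    measurable_convBound (g := fun q : ℝ × Ω => g q.1 q.2)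
      (τ := fun q : ℝ × Ω => δ * (t - q.1)) hg (by fun_prop) _ _
  have hΦ : ∀ p : NonzeroFreq d × Fin (d - 1),
      ∀ᵐ r ∂(volume.restrict (Set.Ioc (s : ℝ) t)), ∀ᵐ ω ∂P,
      ‖heat (δ * ((t : ℝ) - r.toNNReal))
        (helmholtz (transport p.1.1 (a p.1 p.2) (f r.toNNReal ω)))‖ₑ ^ 2 ≤ G p r ω := by
    intro p
    filter_upwards [hfin, ae_restrict_mem measurableSet_Ioc] with r hr hrm
    filter_upwards [hr] with ω hω
    have hr0 : ((r.toNNReal : ℝ≥0) : ℝ) = r :=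
      Real.coe_toNNReal r (le_trans s.2 hrm.1.le)
    rw [← hgf r hrm ω, hr0]
    exact enorm_sq_heat_helmholtz_transport_le hω (ha.perp p.1 p.2) _
  have hbound : ∀ S : Finset (NonzeroFreq d × Fin (d - 1)),
      ∫⁻ ω, ‖∑ p ∈ S, c p • Y p ω‖ₑ ^ 2 ∂P ≤
        ∑' p, 8 * ‖c p‖ₑ ^ 2 * ∫⁻ r in Set.Ioc (s : ℝ) t, ∫⁻ ω, G p r ω ∂P := fun S =>
    (hW.isOrthogonalNoise.lintegral_enorm_sq_sum_ito_le S c hY hG hΦ).trans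
      (ENNReal.sum_le_tsum S)
  have hZle : ∫⁻ ω, ‖Z ω‖ₑ ^ 2 ∂P ≤
      2 * ∑' p, 8 * ‖c p‖ₑ ^ 2 * ∫⁻ r in Set.Ioc (s : ℝ) t, ∫⁻ ω, G p r ω ∂P := by
    have hstep : ∀ S : Finset (NonzeroFreq d × Fin (d - 1)), ∫⁻ ω, ‖Z ω‖ₑ ^ 2 ∂P ≤
        2 * (∑' p, 8 * ‖c p‖ₑ ^ 2 * ∫⁻ r in Set.Ioc (s : ℝ) t, ∫⁻ ω, G p r ω ∂P) +
        2 * ∫⁻ ω, ‖(∑ p ∈ S, c p • Y p ω) - Z ω‖ₑ ^ 2 ∂P := by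
      intro S
      have hm : AEMeasurable (fun ω => 2 * ‖∑ p ∈ S, c p • Y p ω‖ₑ ^ 2) P :=
        ((Finset.aestronglyMeasurable_fun_sum S fun p _ =>
          (hY p).1.const_smul (c p)).enorm.pow_const 2).const_mul _
      refine le_trans ?_ (add_le_add (mul_le_mul_right (hbound S) 2) le_rfl)
      rw [← lintegral_const_mul' _ _ (by simp), ← lintegral_const_mul' _ _ (by simp),
        ← lintegral_add_left' hm]
      refine lintegral_mono fun ω => ?_
      have := enorm_sq_add_le (∑ p ∈ S, c p • Y p ω) (Z ω - ∑ p ∈ S, c p • Y p ω)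
      rw [add_sub_cancel, enorm_sub_rev (Z ω)] at this
      exact this
    have h := ge_of_tendsto' (tendsto_const_nhds.add
      (ENNReal.Tendsto.const_mul hlim (Or.inr (ENNReal.ofNat_ne_top (n := 2))))) hstep
    simpa using h
  -- The 2 comes from the limit of the series, the 8 from the Itô bound, and d/(d-1) ≤ 2 supplies
  -- the rest of 32.
  have hcp : ∀ p, 2 * (8 * ‖c p‖ₑ ^ 2) ≤
      ENNReal.ofReal (32 * κ) * ENNReal.ofReal (θ p.1 ^ 2) := by
    intro p
    have hd1 : (2 : ℝ) ≤ d := by exact_mod_cast hd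
    have hq : (d : ℝ) / ((d : ℝ) - 1) ≤ 2 := by
      rw [div_le_iff₀ (by linarith)]; linarith
    have hq0 : 0 ≤ (d : ℝ) / ((d : ℝ) - 1) := div_nonneg (by linarith) (by linarith)
    rw [← ofReal_norm, ← ENNReal.ofReal_pow (norm_nonneg _), ← ENNReal.ofReal_mul (by positivity)]
    have h2 : (2 : ℝ≥0∞) = ENNReal.ofReal 2 := by simp
    have h8 : (8 : ℝ≥0∞) = ENNReal.ofReal 8 := by simp
    rw [h2, h8, ← ENNReal.ofReal_mul (by norm_num), ← ENNReal.ofReal_mul (by norm_num)]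
    refine ENNReal.ofReal_le_ofReal ?_
    rw [hc, Complex.norm_real, Real.norm_eq_abs, sq_abs, mul_pow, Real.sq_sqrt (by positivity)]
    nlinarith [mul_le_mul_of_nonneg_right hq (by positivity : 0 ≤ κ * θ p.1 ^ 2)]
  refine hZle.trans ?_
  calc _ ≤ ∑' p : NonzeroFreq d × Fin (d - 1), ENNReal.ofReal (32 * κ) *
        (ENNReal.ofReal (θ p.1 ^ 2) * ∫⁻ r in Set.Ioc (s : ℝ) t, ∫⁻ ω, G p r ω ∂P) := by
        rw [← ENNReal.tsum_mul_left]
        refine ENNReal.tsum_le_tsum fun p => ?_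
        have := mul_le_mul' (hcp p)
          (le_refl (∫⁻ r in Set.Ioc (s : ℝ) t, ∫⁻ ω, G p r ω ∂P))
        simpa only [mul_assoc] using this
    _ = ENNReal.ofReal (32 * κ) * ∫⁻ r in Set.Ioc (s : ℝ) t, ∫⁻ ω,
          ∑' p : NonzeroFreq d × Fin (d - 1), ENNReal.ofReal (θ p.1 ^ 2) * G p r ω ∂P := by
        rw [ENNReal.tsum_mul_left]
        rw [tsum_mul_lintegral_lintegral _ hG]
    _ = _ := by simp only [G, tsum_mul_convBound]

theorem le_ofReal_inv_mul_of_add_le {ν : ℝ} (hν : 0 < ν) {x y : ℝ≥0∞} {G : ℝ≥0∞}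
    (h : x + ENNReal.ofReal ν * G ≤ y) : G ≤ ENNReal.ofReal ν⁻¹ * y := by
  have h1 : ENNReal.ofReal ν * G ≤ y := le_trans le_add_self h
  calc G = ENNReal.ofReal ν⁻¹ * (ENNReal.ofReal ν * G) := by
        rw [← mul_assoc, ← ENNReal.ofReal_mul (by positivity), inv_mul_cancel₀ hν.ne',
          ENNReal.ofReal_one, one_mul]
    _ ≤ _ := by gcongr

/-- Hölder in time: one factor is bounded by the integrated dissipation, the other pointwise by the
initial energy, and λ + μ = 1 restores a single power of y. -/
theorem lintegral_interpolation_le {ν : ℝ} (hν : 0 < ν) {lam μ : ℝ} (hlam : 0 < lam) (hμ : 0 < μ)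
    (hlm : lam + μ = 1) {m : Measure ℝ} [IsProbabilityMeasure m] {g F : ℝ → ℝ≥0∞} {y : ℝ≥0∞}
    (hgm : AEMeasurable g m) (hF : ∀ᵐ r ∂m, F r ≤ y)
    (hgI : ∫⁻ r, g r ∂m ≤ ENNReal.ofReal ν⁻¹ * y) :
    ∫⁻ r, g r ^ lam * F r ^ μ ∂m ≤ ENNReal.ofReal (ν ^ (-lam)) * y := by
  calc _ ≤ ∫⁻ r, g r ^ lam * y ^ μ ∂m :=
        lintegral_mono_ae (hF.mono fun r hr => by gcongr)
    _ ≤ (∫⁻ r, g r ∂m) ^ lam * (∫⁻ _, y ∂m) ^ μ :=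
        ENNReal.lintegral_mul_norm_pow_le (g := fun _ => y) hgm aemeasurable_const hlam.le hμ.le hlm
    _ ≤ (ENNReal.ofReal ν⁻¹ * y) ^ lam * y ^ μ := by
        rw [lintegral_const, measure_univ, mul_one]
        gcongr
    _ = _ := by
        rw [ENNReal.mul_rpow_of_nonneg _ _ hlam.le, mul_assoc,
          ← ENNReal.rpow_add_of_nonneg _ _ hlam.le hμ.le, hlm, ENNReal.rpow_one,
          ENNReal.ofReal_rpow_of_pos (by positivity), Real.inv_rpow hν.le, ← Real.rpow_neg hν.le]

theorem lintegral_lintegral_interpolation_le [SFinite P] {ν : ℝ} (hν : 0 < ν) {lam μ : ℝ}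
    (hlam : 0 < lam) (hμ : 0 < μ) (hlm : lam + μ = 1) {m : Measure ℝ} [IsProbabilityMeasure m]
    {g F : ℝ → Ω → ℝ≥0∞} {y : Ω → ℝ≥0∞} (hg : Measurable (Function.uncurry g))
    (hFm : Measurable (Function.uncurry F)) (hF : ∀ᵐ ω ∂P, ∀ᵐ r ∂m, F r ω ≤ y ω)
    (hgI : ∀ᵐ ω ∂P, ∫⁻ r, g r ω ∂m ≤ ENNReal.ofReal ν⁻¹ * y ω) (K : ℝ≥0∞) :
    ∫⁻ r, ∫⁻ ω, K * (g r ω ^ lam * F r ω ^ μ) ∂P ∂m ≤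
      K * (ENNReal.ofReal (ν ^ (-lam)) * ∫⁻ ω, y ω ∂P) := by
  have hm : Measurable fun q : ℝ × Ω => g q.1 q.2 ^ lam * F q.1 q.2 ^ μ :=
    (hg.pow_const _).mul (hFm.pow_const _)
  have hI : Measurable fun ω => ∫⁻ r, g r ω ^ lam * F r ω ^ μ ∂m := hm.lintegral_prod_left'
  rw [lintegral_lintegral_swap (hm.const_mul K).aemeasurable]
  have h1 : ∀ ω, ∫⁻ r, K * (g r ω ^ lam * F r ω ^ μ) ∂m =
      K * ∫⁻ r, g r ω ^ lam * F r ω ^ μ ∂m := fun ω =>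
    lintegral_const_mul _ (hm.comp measurable_prodMk_right)
  rw [lintegral_congr h1, lintegral_const_mul _ hI, ← lintegral_const_mul' _ _ ENNReal.ofReal_ne_top]
  refine mul_le_mul_right (lintegral_mono_ae ?_) K
  filter_upwards [hF, hgI] with ω h2 h3
  have hgω : Measurable fun r => g r ω := hg.comp measurable_prodMk_right
  exact lintegral_interpolation_le hν hlam hμ hlm hgω.aemeasurable h2 h3

theorem lintegral_stochConvolution_le [IsProbabilityMeasure P] {κ ν δ : ℝ} (hκ : 0 < κ)
    (hν : 0 < ν) (hδ : 0 < δ) (hd : 2 ≤ d) {θ : NonzeroFreq d → ℝ} (hθ : IsNoiseCoeff θ)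
    {T : ℝ} (hT : ∀ k, |θ k| ≤ T)
    {a : NonzeroFreq d → Fin (d - 1) → EuclideanSpace ℝ (Fin d)} (ha : IsNoiseFrame a)
    {W : NonzeroFreq d → Fin (d - 1) → ℝ≥0 → Ω → ℂ} (hW : IsNoise 𝓕 P W)
    {f : ℝ≥0 → Ω → VectorField d} (hf : IsStronglyProgressive 𝓕 f)
    (hE : EnergyInequality P ν f) {n : ℝ≥0} {Z : ℝ≥0 → Ω → VectorField d}
    (hZ : ∀ t ∈ Set.Icc n (n + 1), IsStochConvolution 𝓕 P κ δ θ a W f n t (Z t))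
    {lam μ b : ℝ} (hlam : 0 < lam) (hμ : 0 < μ) (hlm : lam + μ = 1) (hb : 0 < b)
    (hη : μ * (b + 1) ≤ 1) :
    ∫⁻ t in Set.Icc (n : ℝ) (n + 1), ∫⁻ ω, ‖Z t.toNNReal ω‖ₑ ^ 2 ∂P ≤
      ENNReal.ofReal (32 * κ) * (latticeSum d b ^ μ * ENNReal.ofReal (T ^ 2) ^ μ *
        ENNReal.ofReal (δ ^ (-(μ * (b + 1))))) * (ENNReal.ofReal (ν ^ (-lam)) *
          ∫⁻ ω, ‖f n ω‖ₑ ^ 2 ∂P) := by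
  let g : ℝ → Ω → VectorField d := fun r ω => f (min r.toNNReal (n + 1)) ω
  have hg : StronglyMeasurable (Function.uncurry g) :=
    stronglyMeasurable_stopped_uncurry hf (n + 1)
  have hgf : ∀ r ∈ Set.Ioc (n : ℝ) (n + 1), ∀ ω, g r ω = f r.toNNReal ω := by
    intro r hr ω
    have : r.toNNReal ≤ n + 1 := Real.toNNReal_le_iff_le_coe.2 (by push_cast; exact hr.2)
    simp only [g, min_eq_left this]
  have hprob : IsProbabilityMeasure (volume.restrict (Set.Ioc (n : ℝ) (n + 1))) :=
    ⟨by rw [Measure.restrict_apply_univ, Real.volume_Ioc]; simp⟩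
  have hgradm : Measurable fun q : ℝ × Ω => gradNormSq (g q.1 q.2) :=
    measurable_gradNormSq_comp hg
  have hgrad : ∀ᵐ ω ∂P, ∫⁻ r in Set.Ioc (n : ℝ) (n + 1), gradNormSq (g r ω) ≤
      ENNReal.ofReal ν⁻¹ * ‖f n ω‖ₑ ^ 2 := by
    filter_upwards [hE] with ω hω
    have h := le_ofReal_inv_mul_of_add_le hν (hω n (n + 1) (by simp))
    rw [setLIntegral_congr_fun measurableSet_Ioc fun r hr => by rw [hgf r hr ω]]
    simpa using h
  have hfin : ∀ᵐ r ∂(volume.restrict (Set.Ioc (n : ℝ) (n + 1))), ∀ᵐ ω ∂P,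
      gradNormSq (g r ω) ≠ ∞ := by
    have hms : MeasurableSet {q : ℝ × Ω | gradNormSq (g q.1 q.2) ≠ ∞} :=
      hgradm (measurableSet_singleton ∞).compl
    -- The energy inequality gives finiteness for almost every time on each path, while the isometry
    -- needs it almost surely at almost every time.
    rw [Measure.ae_ae_comm hms]
    filter_upwards [hgrad] with ω hω
    have := ae_lt_top (hgradm.comp (measurable_prodMk_right (y := ω)))
      (ne_top_of_le_ne_top (by finiteness) hω)
    exact this.mono fun r hr => hr.ne
  -- The indicator of r ≤ t turns the triangle of integration into a square, so that t can be
  -- integrated first.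
  let A : ℝ → ℝ → Ω → ℝ≥0∞ := fun t r ω => ∑' l,
    (Set.Ici r).indicator (fun t => ENNReal.ofReal
      (Real.exp (-(2 * (4 * Real.pi ^ 2 * freqSq l) * (δ * (t - r)))))) t *
      modeEnergy θ a (g r ω) l
  have hAm : Measurable fun q : ℝ × ℝ × Ω => A q.1 q.2.1 q.2.2 := by
    refine Measurable.tsum fun l => Measurable.mul ?_ ?_
    · have hset : MeasurableSet {q : ℝ × ℝ × Ω | q.2.1 ≤ q.1} :=
        measurableSet_le (by fun_prop) (by fun_prop)
      exact Measurable.indicator (f := fun q : ℝ × ℝ × Ω => ENNReal.ofReal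
        (Real.exp (-(2 * (4 * Real.pi ^ 2 * freqSq l) * (δ * (q.1 - q.2.1))))))
        (by fun_prop) hset
    · exact (measurable_modeEnergy hg θ a l).comp measurable_snd
  have hfirst : ∫⁻ t in Set.Icc (n : ℝ) (n + 1), ∫⁻ ω, ‖Z t.toNNReal ω‖ₑ ^ 2 ∂P ≤
      ENNReal.ofReal (32 * κ) * ∫⁻ t in Set.Icc (n : ℝ) (n + 1),
        ∫⁻ r in Set.Ioc (n : ℝ) (n + 1), ∫⁻ ω, A t r ω ∂P := by
    rw [← lintegral_const_mul' _ _ ENNReal.ofReal_ne_top]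
    refine setLIntegral_mono' measurableSet_Icc fun t ht => ?_
    have ht0 : ((t.toNNReal : ℝ≥0) : ℝ) = t := Real.coe_toNNReal t (le_trans n.2 ht.1)
    have htm : t.toNNReal ∈ Set.Icc n (n + 1) := by
      refine ⟨?_, ?_⟩
      · rw [← NNReal.coe_le_coe, ht0]; exact ht.1
      · rw [← NNReal.coe_le_coe, ht0]; push_cast; exact ht.2
    have hsub : Set.Ioc (n : ℝ) t ⊆ Set.Ioc (n : ℝ) (n + 1) := Set.Ioc_subset_Ioc_right ht.2
    have h := lintegral_enorm_sq_stochConvolution_le hκ hd ha hW hg (s := n) (t := t.toNNReal)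
      (fun r hr => hgf r (hsub (ht0 ▸ hr)))
      (by rw [ht0]; exact ae_restrict_of_ae_restrict_of_subset hsub hfin) (hZ _ htm)
    rw [ht0] at h
    refine h.trans (mul_le_mul_right (le_trans ?_ (lintegral_mono_set hsub)) _)
    refine setLIntegral_mono' measurableSet_Ioc fun r hr => le_of_eq ?_
    simp only [A, Set.indicator_of_mem (Set.mem_Ici.2 hr.2)]
  have hswap : ∫⁻ t in Set.Icc (n : ℝ) (n + 1), ∫⁻ r in Set.Ioc (n : ℝ) (n + 1),
      ∫⁻ ω, A t r ω ∂P = ∫⁻ r in Set.Ioc (n : ℝ) (n + 1), ∫⁻ ω,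
        (∫⁻ t in Set.Icc (n : ℝ) (n + 1), A t r ω) ∂P := by
    rw [lintegral_lintegral_swap]
    · refine lintegral_congr fun r => ?_
      rw [lintegral_lintegral_swap]
      exact (hAm.comp (measurable_fst.prodMk
        (measurable_const.prodMk measurable_snd))).aemeasurable
    · exact Measurable.aemeasurable (Measurable.lintegral_prod_right'
        (f := fun q : (ℝ × ℝ) × Ω => A q.1.1 q.1.2 q.2) (hAm.comp
          ((measurable_fst.comp measurable_fst).prodMk
            ((measurable_snd.comp measurable_fst).prodMk measurable_snd))))
  have hA : ∀ r ω, ∫⁻ t in Set.Icc (n : ℝ) (n + 1), A t r ω ≤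
      latticeSum d b ^ μ * ENNReal.ofReal (T ^ 2) ^ μ * ENNReal.ofReal (δ ^ (-(μ * (b + 1)))) *
        (gradNormSq (g r ω) ^ lam * (‖g r ω‖ₑ ^ 2) ^ μ) := by
    intro r ω
    refine le_trans ?_ (tsum_modeEnergy_mul_le hθ ha hT hlam hμ hlm hδ (g r ω))
    have hm : ∀ l : Fin d → ℤ, Measurable ((Set.Ici r).indicator (fun t => ENNReal.ofReal
      (Real.exp (-(2 * (4 * Real.pi ^ 2 * freqSq l) * (δ * (t - r))))))) := fun l =>
      Measurable.indicator (by fun_prop) measurableSet_Ici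
    simp only [A]
    rw [lintegral_tsum fun l => ((hm l).mul_const _).aemeasurable]
    refine ENNReal.tsum_le_tsum fun l => ?_
    rw [lintegral_mul_const _ (hm l)]
    by_cases hl : l = 0
    · have h0 : freqSq l = 0 := by simp [hl, freqSq]
      have : modeEnergy θ a (g r ω) l = 0 := by simpa [h0] using modeEnergy_le ha hT (g r ω) l
      simp [this]
    · have hx : 0 < 4 * Real.pi ^ 2 * freqSq l := by have := freqSq_pos hl; positivity
      gcongr
      exact lintegral_exp_neg_le hx hδ (by positivity) hη n r
  have hFm : Measurable (Function.uncurry fun r ω => ‖g r ω‖ₑ ^ 2) := hg.enorm.pow_const 2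
  have hF : ∀ᵐ ω ∂P, ∀ᵐ r ∂(volume.restrict (Set.Ioc (n : ℝ) (n + 1))),
      ‖g r ω‖ₑ ^ 2 ≤ ‖f n ω‖ₑ ^ 2 := by
    filter_upwards [hE] with ω hω
    filter_upwards [ae_restrict_mem measurableSet_Ioc] with r hr
    rw [hgf r hr ω]
    exact le_trans le_self_add (hω n r.toNNReal (Real.lt_toNNReal_iff_coe_lt.2 hr.1))
  refine hfirst.trans ?_
  rw [hswap, mul_assoc]
  refine mul_le_mul_right ?_ _
  exact (lintegral_mono fun r => lintegral_mono fun ω => hA r ω).trans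
    (lintegral_lintegral_interpolation_le (g := fun r ω => gradNormSq (g r ω))
      hν hlam hμ hlm hgradm hFm hF hgrad _)

end TransportNoise

/-! ### Choice of exponents and of the constant. -/

theorem theorem3p4 (α β : ℝ) (hα₀ : 0 < α) (hα₁ : α < 1) :
    ∃ C : ℝ, 0 < C ∧
      ∀ (d : ℕ), 1 ≤ (d : ℝ) / 2 → (d : ℝ) / 2 < β →
      ∀ (κ ν δ : ℝ), 0 < κ → 0 < ν → 0 < δ →
      ∀ (θ : TransportNoise.NonzeroFreq d → ℝ), TransportNoise.IsNoiseCoeff θ →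
      ∀ (a : TransportNoise.NonzeroFreq d → Fin (d - 1) → EuclideanSpace ℝ (Fin d)),
        TransportNoise.IsNoiseFrame a →
      ∀ (Ω : Type*) [mΩ : MeasurableSpace Ω] (P : Measure Ω) [IsProbabilityMeasure P]
        (𝓕 : Filtration ℝ≥0 mΩ)
        (W : TransportNoise.NonzeroFreq d → Fin (d - 1) → ℝ≥0 → Ω → ℂ),
        TransportNoise.IsNoise 𝓕 P W →
      ∀ (f : ℝ≥0 → Ω → TransportNoise.VectorField d),
        IsStronglyProgressive 𝓕 f →
        (∀ t ω, TransportNoise.IsRealField (f t ω) ∧ TransportNoise.HasZeroMean (f t ω)) →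
        TransportNoise.EnergyInequality P ν f →
      ∀ (n : ℝ≥0) (Z : ℝ≥0 → Ω → TransportNoise.VectorField d),
        (∀ t ∈ Set.Icc n (n + 1),
          TransportNoise.IsStochConvolution 𝓕 P κ δ θ a W f n t (Z t)) →
        ∫⁻ t in Set.Icc (n : ℝ) (n + 1), ∫⁻ ω, ‖Z t.toNNReal ω‖ₑ ^ 2 ∂P ≤
          ENNReal.ofReal (C * κ * ν ^ (-(β / (α + β)))
              * δ ^ (-(α * (2 * β + d + 4) / (4 * (α + β))))
              * (⨆ k, |θ k|) ^ (2 * α / (α + β)))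
            * ∫⁻ ω, ‖f n ω‖ₑ ^ 2 ∂P := by
  let μ : ℝ := α / (α + β)
  let K : ℕ → ℝ := fun d => 32 * (TransportNoise.latticeSum d ((2 * β + d) / 4)).toReal ^ μ
  have hK : ∀ d, 0 ≤ K d := fun d => by positivity
  -- The lattice constant depends on d, but d < 2β leaves finitely many dimensions; summing over
  -- them gives a constant in α and β alone.
  refine ⟨1 + ∑ d ∈ Finset.range (⌈2 * β⌉₊ + 1), K d,
    by have := Finset.sum_nonneg fun d (_ : d ∈ Finset.range (⌈2 * β⌉₊ + 1)) => hK d; linarith, ?_⟩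
  intro d hd1 hdβ κ ν δ hκ hν hδ θ hθ a ha Ω mΩ P _ 𝓕 W hW f hf _ hE n Z hZ
  have hd : 2 ≤ d := by
    have : (2 : ℝ) ≤ d := by linarith
    exact_mod_cast this
  have hβ : 0 < β := by linarith
  have hαβ : 0 < α + β := by linarith
  have hμ : 0 < μ := div_pos hα₀ hαβ
  -- The midpoint of d/2 and β: above d/2 for the lattice sum, below β for the time exponent.
  set b : ℝ := (2 * β + d) / 4 with hb
  have hb0 : 0 < b := by positivity
  have hdb : (d : ℝ) / 2 < b := by rw [hb]; linarith
  -- Since b ≤ β and α < 1, α(b+1) ≤ αβ + α ≤ α + β.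
  have hη : μ * (b + 1) ≤ 1 := by
    rw [div_mul_eq_mul_div, div_le_one hαβ]
    have : b ≤ β := by rw [hb]; linarith
    nlinarith
  have hlm : β / (α + β) + μ = 1 := by
    rw [← add_div, add_comm, div_self hαβ.ne']
  have hbdd : BddAbove (Set.range fun k => |θ k|) := by
    refine ⟨1, ?_⟩
    rintro _ ⟨k, rfl⟩
    have h1 : θ k ^ 2 ≤ 1 := le_hasSum hθ.norm_one k fun _ _ => by positivity
    exact abs_le_one_iff_mul_self_le_one.2 (by nlinarith)
  set T : ℝ := ⨆ k, |θ k| with hTdef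
  have hT : ∀ k, |θ k| ≤ T := fun k => le_ciSup hbdd k
  have hT0 : 0 ≤ T := Real.iSup_nonneg fun k => abs_nonneg _
  have hmain := TransportNoise.lintegral_stochConvolution_le hκ hν hδ hd hθ hT ha hW hf hE hZ
    (div_pos hβ hαβ) hμ hlm hb0 hη
  refine hmain.trans ?_
  rw [← mul_assoc]
  refine mul_le_mul_left ?_ _
  have hfin := TransportNoise.latticeSum_ne_top (d := d) hdb
  rw [← ENNReal.ofReal_toReal hfin, ENNReal.ofReal_rpow_of_nonneg ENNReal.toReal_nonneg hμ.le,
    ENNReal.ofReal_rpow_of_nonneg (by positivity) hμ.le, ← ENNReal.ofReal_mul (by positivity),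
    ← ENNReal.ofReal_mul (by positivity), ← ENNReal.ofReal_mul (by positivity),
    ← ENNReal.ofReal_mul (by positivity)]
  refine ENNReal.ofReal_le_ofReal ?_
  have hTpow : (T ^ 2) ^ μ = T ^ (2 * α / (α + β)) := by
    rw [← Real.rpow_natCast, ← Real.rpow_mul hT0]
    congr 1
    simp only [μ]
    push_cast
    ring
  have hexp : -(μ * (b + 1)) = -(α * (2 * β + d + 4) / (4 * (α + β))) := by
    simp only [μ, hb]
    field_simp
  have hKle : K d ≤ 1 + ∑ d ∈ Finset.range (⌈2 * β⌉₊ + 1), K d := by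
    have hmem : d ∈ Finset.range (⌈2 * β⌉₊ + 1) := by
      rw [Finset.mem_range, Nat.lt_succ_iff]
      have : (d : ℝ) ≤ ⌈2 * β⌉₊ := le_trans (by linarith) (Nat.le_ceil _)
      exact_mod_cast this
    have := Finset.single_le_sum (f := K) (fun d _ => hK d) hmem
    linarith
  rw [hTpow, hexp]
  calc _ = K d * κ * ν ^ (-(β / (α + β))) * δ ^ (-(α * (2 * β + d + 4) / (4 * (α + β)))) *
        T ^ (2 * α / (α + β)) := by
        simp only [K]
        ring
    _ ≤ _ := by gcongr
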